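/- Let $K$ be an algebraically closed field. A closed subscheme $Y\subset\mathbb P^N_K$ has *good postulation* if for every $d\ge 1$ the restriction map $H^0(\mathbb P^N,\mathcal O(d))\to H^0(Y,\mathcal O_Y(d))$ has maximal rank, i.e. is injective or surjective. For non-negative integers $a,b$, a *sub-star* $P(a,b)$ in $\mathbb P^2$ is obtained from $a$ lines in general position by taking all their $\binom a2$ pairwise intersection points and omitting $b$ of them, in such a way that each of the $a$ lines contains at most one omitted point. Let $T(e,s,m,(a,b),p)$ denote a subscheme of $\mathbb P^2$ which is the union of $e$ general lines, $s$ general double points (a double point is the scheme defined by $\mathfrak m_P^2$), $m$ general subschemes of length $2$ supported at one point each (a general point with a general tangent direction), a sub-star $P(a,b)$ defined by $a$ general lines, with any admissible choice of the omitted points, and $p$ general points. Write $T(e,s,m,(a,b),p+\mathbf q)$ if moreover $q$ general points of one further general line are added. **Theorem.** Let $k\ge 1$ be an integer. Each of the following schemes for which all the displayed numbers are non-negative integers has good postulation (for a general choice of its components, i.e. on a non-empty Zariski open subset of the parameter space, for each admissible choice of omitted points). For $k$ odd: 1. $T\left(k+1,0,\frac12k(k-1)-2,(k+1,\frac12(k+1)),\frac12(k^2+4k+9)\right)$,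 2. $T\left(k,3,\frac12(k^2-1)-k-2,(k+1,2),\frac12k(k+5)-2\right)$, 3. $T\left(k,\frac12(k+1),\frac12k(k-3),(k,\frac12(k-1)),\frac12k(k+3)-2\right)$, 4. $T\left(k,1,\frac12(k^2-2k-1),(k+1,0),\frac12k(k+5)-2\right)$, 5. $T\left(k,1,\frac12(k^2-4k-1),(k+2,0),\frac12k(k+11)-2\right)$, 6. $T\left(k,\frac12(3k+1),\frac12k(k-5),(k,\frac12(k-1)),\frac12k(k+5)-2\right)$, 7. $T\left(k,k+2,\frac12(k^2-4k-3),(k+2,0),\frac12k(k+9)-1\right)$, 8. $T\left(k+1,\frac12(k-1),\frac12(k^2+1)-k-2,(k,\frac12(k-1)),\frac12k(k+5)+4\right)$. For $k$ even: 9. $T\left(k+1,0,\frac12k(k-1)-1,(k+1,\frac12k),\frac12(k+2)^2\right)$, 10. $T\left(k,1,\frac12k(k-2)-1,(k+1,1),\frac12k(k+5)\right)$, 11. $T\left(k,\frac12k,\frac12k(k-3),(k,\frac12k),\frac12k(k+3)\right)$, 12. $T\left(k,0,\frac12k(k-2),(k+1,0),\frac12k(k+5)\right)$, 13. $T\left(k,0,\frac12k(k-4),(k+2,0),\frac12k(k+11)\right)$,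 14. $T\left(k,\frac32k,\frac12k(k-5),(k,\frac12k),\frac12k(k+5)\right)$, 15. $T\left(k,k+1,\frac12k(k-4)-1,(k+2,0),\frac12k(k+9)+1\right)$, 16. $T\left(k+1,\frac12k,\frac12k(k-2)-1,(k,\frac12k),\frac12k(k+5)+2\right)$. For every $k$: 17. $T\left(k+1,\frac12k(k-1),0,(0,0),\frac12k(k+5)\right)$, 18. $T\left(k+2,\frac12k(k-3),0,(0,0),\frac12k(k+11)\right)$, 19. $T\left(k+2,\frac12k(k-3)-1,0,(0,0),\frac12k(k+13)+3+(\mathbf{k+1})\right)$. -/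

import Mathlib

/-! Postulation of closed subschemes of a projective space, and the plane trace schemes. -/

/-- A closed subscheme of `ℙ^N` over `K` is given by a homogeneous ideal `I` of
`K[X_0, …, X_N]`.  `coordAway I i` is the ring `A_{x_i}`, where `A = K[X_0, …, X_N] / I`. -/
abbrev coordAway {K : Type*} [Field K] {N : ℕ} (I : Ideal (MvPolynomial (Fin (N + 1)) K))
    (i : Fin (N + 1)) : Type _ :=
  Localization.Away (Ideal.Quotient.mk I (MvPolynomial.X i))

/-- The ring `A_{x_i x_j}`, where `A = K[X_0, …, X_N] / I`. -/
abbrev coordAway₂ {K : Type*} [Field K] {N : ℕ} (I : Ideal (MvPolynomial (Fin (N + 1)) K))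
    (i j : Fin (N + 1)) : Type _ :=
  Localization.Away
    (Ideal.Quotient.mk I (MvPolynomial.X i) * Ideal.Quotient.mk I (MvPolynomial.X j))

/-- Restriction `A_{x_i} → A_{x_i x_j}`. -/
noncomputable def toOverlapLeft {K : Type*} [Field K] {N : ℕ}
    (I : Ideal (MvPolynomial (Fin (N + 1)) K)) (i j : Fin (N + 1)) :
    coordAway I i →ₐ[K] coordAway₂ I i j :=
  IsLocalization.Away.liftAlgHom (Ideal.Quotient.mk I (MvPolynomial.X i))
    (f := IsScalarTower.toAlgHom K (MvPolynomial (Fin (N + 1)) K ⧸ I) (coordAway₂ I i j))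
    (IsLocalization.Away.isUnit_of_dvd
      (Ideal.Quotient.mk I (MvPolynomial.X i) * Ideal.Quotient.mk I (MvPolynomial.X j))
      (dvd_mul_right _ _))

/-- Restriction `A_{x_j} → A_{x_i x_j}`. -/
noncomputable def toOverlapRight {K : Type*} [Field K] {N : ℕ}
    (I : Ideal (MvPolynomial (Fin (N + 1)) K)) (i j : Fin (N + 1)) :
    coordAway I j →ₐ[K] coordAway₂ I i j :=
  IsLocalization.Away.liftAlgHom (Ideal.Quotient.mk I (MvPolynomial.X j))
    (f := IsScalarTower.toAlgHom K (MvPolynomial (Fin (N + 1)) K ⧸ I) (coordAway₂ I i j))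
    (IsLocalization.Away.isUnit_of_dvd
      (Ideal.Quotient.mk I (MvPolynomial.X i) * Ideal.Quotient.mk I (MvPolynomial.X j))
      (dvd_mul_left _ _))

theorem toOverlapLeft_algebraMap {K : Type*} [Field K] {N : ℕ}
    (I : Ideal (MvPolynomial (Fin (N + 1)) K)) (i j : Fin (N + 1))
    (a : MvPolynomial (Fin (N + 1)) K ⧸ I) :
    toOverlapLeft I i j (algebraMap _ (coordAway I i) a) = algebraMap _ (coordAway₂ I i j) a := by
  exact IsLocalization.Away.lift_eq (S := coordAway I i)
    (g := algebraMap (MvPolynomial (Fin (N + 1)) K ⧸ I) (coordAway₂ I i j)) _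
    (IsLocalization.Away.isUnit_of_dvd
      (Ideal.Quotient.mk I (MvPolynomial.X i) * Ideal.Quotient.mk I (MvPolynomial.X j))
      (dvd_mul_right _ _)) a

theorem toOverlapRight_algebraMap {K : Type*} [Field K] {N : ℕ}
    (I : Ideal (MvPolynomial (Fin (N + 1)) K)) (i j : Fin (N + 1))
    (a : MvPolynomial (Fin (N + 1)) K ⧸ I) :
    toOverlapRight I i j (algebraMap _ (coordAway I j) a) = algebraMap _ (coordAway₂ I i j) a := by
  exact IsLocalization.Away.lift_eq (S := coordAway I j)
    (g := algebraMap (MvPolynomial (Fin (N + 1)) K ⧸ I) (coordAway₂ I i j)) _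
    (IsLocalization.Away.isUnit_of_dvd
      (Ideal.Quotient.mk I (MvPolynomial.X i) * Ideal.Quotient.mk I (MvPolynomial.X j))
      (dvd_mul_left _ _)) a

/-- The degree `d` part of `A_{x_i}`, that is, the sections of `𝒪_Y(d)` over the affine chart
`x_i ≠ 0` of the subscheme `Y` given by `I`: fractions `f / x_i ^ n` with `f` a form of
degree `n + d`. -/
def chartSections {K : Type*} [Field K] {N : ℕ} (I : Ideal (MvPolynomial (Fin (N + 1)) K))
    (d : ℕ) (i : Fin (N + 1)) : Submodule K (coordAway I i) where
  carrier := {s | ∃ (n : ℕ) (f : MvPolynomial (Fin (N + 1)) K), f.IsHomogeneous (n + d) ∧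
    s * algebraMap _ _ (Ideal.Quotient.mk I (MvPolynomial.X i)) ^ n =
      algebraMap _ _ (Ideal.Quotient.mk I f)}
  zero_mem' := ⟨0, 0, MvPolynomial.isHomogeneous_zero _ _ _, by simp⟩
  add_mem' := by
    rintro s t ⟨n, f, hf, hs⟩ ⟨m, g, hg, ht⟩
    refine ⟨n + m, f * MvPolynomial.X i ^ m + g * MvPolynomial.X i ^ n, ?_, ?_⟩
    · refine MvPolynomial.IsHomogeneous.add ?_ ?_
      · have h := hf.mul (MvPolynomial.isHomogeneous_X_pow (R := K) i m)
        rwa [show n + d + m = n + m + d by ring] at h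
      · have h := hg.mul (MvPolynomial.isHomogeneous_X_pow (R := K) i n)
        rwa [show m + d + n = n + m + d by ring] at h
    · simp only [map_add, map_mul, map_pow]
      rw [← hs, ← ht]
      ring
  smul_mem' := by
    rintro c s ⟨n, f, hf, hs⟩
    refine ⟨n, MvPolynomial.C c * f, ?_, ?_⟩
    · have h := (MvPolynomial.isHomogeneous_C (Fin (N + 1)) c).mul hf
      rwa [zero_add] at h
    · rw [Algebra.smul_mul_assoc, hs, ← MvPolynomial.smul_eq_C_mul]
      exact (map_smul ((IsScalarTower.toAlgHom K (MvPolynomial (Fin (N + 1)) K ⧸ I)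
        (coordAway I i)).comp (Ideal.Quotient.mkₐ K I)) c f).symm

/-- `H⁰(Y, 𝒪_Y(d))` for the closed subscheme `Y` of `ℙ^N` given by `I`: families of sections
over the charts `x_i ≠ 0` which agree on the overlaps `x_i x_j ≠ 0`. -/
def globalSections {K : Type*} [Field K] {N : ℕ} (I : Ideal (MvPolynomial (Fin (N + 1)) K))
    (d : ℕ) : Submodule K (Π i, coordAway I i) where
  carrier := {s | (∀ i, s i ∈ chartSections I d i) ∧
    ∀ i j, toOverlapLeft I i j (s i) = toOverlapRight I i j (s j)}
  zero_mem' := ⟨fun i => (chartSections I d i).zero_mem, fun i j => by simp⟩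
  add_mem' := by
    rintro s t ⟨hs, hs'⟩ ⟨ht, ht'⟩
    exact ⟨fun i => (chartSections I d i).add_mem (hs i) (ht i), fun i j => by
      simp only [Pi.add_apply, map_add, hs' i j, ht' i j]⟩
  smul_mem' := by
    rintro c s ⟨hs, hs'⟩
    exact ⟨fun i => (chartSections I d i).smul_mem c (hs i), fun i j => by
      simp only [Pi.smul_apply, map_smul, hs' i j]⟩

/-- The restriction map `H⁰(ℙ^N, 𝒪(d)) → H⁰(Y, 𝒪_Y(d))`, where `H⁰(ℙ^N, 𝒪(d))` is the space of
forms of degree `d`. -/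
noncomputable def restrictionMap {K : Type*} [Field K] {N : ℕ}
    (I : Ideal (MvPolynomial (Fin (N + 1)) K)) (d : ℕ) :
    MvPolynomial.homogeneousSubmodule (Fin (N + 1)) K d →ₗ[K] globalSections I d :=
  LinearMap.codRestrict (globalSections I d)
    ((LinearMap.pi fun i => ((IsScalarTower.toAlgHom K (MvPolynomial (Fin (N + 1)) K ⧸ I)
      (coordAway I i)).comp (Ideal.Quotient.mkₐ K I)).toLinearMap).comp
        (MvPolynomial.homogeneousSubmodule (Fin (N + 1)) K d).subtype)
    (fun f => ⟨fun i => ⟨0, f, by rw [zero_add]; exact f.2, by simp⟩, fun i j =>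
      (toOverlapLeft_algebraMap I i j (Ideal.Quotient.mk I f)).trans
        (toOverlapRight_algebraMap I i j (Ideal.Quotient.mk I f)).symm⟩)

/-- The closed subscheme given by `I` has good postulation: for every `d ≥ 1` the restriction
map has maximal rank. -/
def GoodPostulation {K : Type*} [Field K] {N : ℕ}
    (I : Ideal (MvPolynomial (Fin (N + 1)) K)) : Prop :=
  ∀ d : ℕ, 1 ≤ d →
    Function.Injective (restrictionMap I d) ∨ Function.Surjective (restrictionMap I d)

/-- The linear form `v_0 X_0 + v_1 X_1 + v_2 X_2`. -/
noncomputable def lineForm {K : Type*} [Field K] (v : Fin 3 → K) : MvPolynomial (Fin 3) K :=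
  ∑ i, MvPolynomial.C (v i) * MvPolynomial.X i

/-- The homogeneous ideal of the line `v_0 X_0 + v_1 X_1 + v_2 X_2 = 0`. -/
noncomputable def lineIdeal {K : Type*} [Field K] (v : Fin 3 → K) :
    Ideal (MvPolynomial (Fin 3) K) :=
  Ideal.span {lineForm v}

/-- The homogeneous ideal of the point `(P_0 : P_1 : P_2)`. -/
noncomputable def pointIdeal {K : Type*} [Field K] (P : Fin 3 → K) :
    Ideal (MvPolynomial (Fin 3) K) :=
  Ideal.span (Set.range fun ij : Fin 3 × Fin 3 =>
    MvPolynomial.C (P ij.1) * MvPolynomial.X ij.2 - MvPolynomial.C (P ij.2) * MvPolynomial.X ij.1)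

/-- The ideal of the double point (first infinitesimal neighbourhood) supported at `P`. -/
noncomputable def doublePointIdeal {K : Type*} [Field K] (P : Fin 3 → K) :
    Ideal (MvPolynomial (Fin 3) K) :=
  pointIdeal P ^ 2

/-- The ideal of the subscheme of length 2 supported at `P` and contained in the line `PQ`. -/
noncomputable def lengthTwoIdeal {K : Type*} [Field K] (P Q : Fin 3 → K) :
    Ideal (MvPolynomial (Fin 3) K) :=
  doublePointIdeal P ⊔ lineIdeal (crossProduct P Q)

/-- Numerical type of a trace scheme `T(lines, doubles, lengthTwos, (starLines, omitted), points)`,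
with additional `collinear` points on one line. -/
structure TraceType where
  /-- number of lines -/
  lines : ℕ
  /-- number of double points -/
  doubles : ℕ
  /-- number of subschemes of length 2 -/
  lengthTwos : ℕ
  /-- number `a` of lines of the star configuration of the sub-star `P(a, b)` -/
  starLines : ℕ
  /-- number `b` of omitted points in the sub-star `P(a, b)` -/
  omitted : ℕ
  /-- number of points -/
  points : ℕ
  /-- number of additional points lying on one common line -/
  collinear : ℕ

/-- The homogeneous coordinates on which a trace scheme of type `t` depends. -/
inductive TraceType.Coord (t : TraceType) : Type
  /-- coefficients of the equation of the `i`-th line -/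
  | line (i : Fin t.lines) (c : Fin 3)
  /-- the `i`-th double point -/
  | double (i : Fin t.doubles) (c : Fin 3)
  /-- support of the `i`-th subscheme of length 2 -/
  | support (i : Fin t.lengthTwos) (c : Fin 3)
  /-- second point on the line spanned by the `i`-th subscheme of length 2 -/
  | direction (i : Fin t.lengthTwos) (c : Fin 3)
  /-- coefficients of the equation of the `i`-th line of the star configuration -/
  | star (i : Fin t.starLines) (c : Fin 3)
  /-- the `i`-th point -/
  | point (i : Fin t.points) (c : Fin 3)
  /-- two points spanning the line that contains the collinear points -/
  | base (e : Fin 2) (c : Fin 3)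
  /-- coordinates on that line of the `i`-th collinear point, with respect to the two points -/
  | collinear (i : Fin t.collinear) (e : Fin 2)

/-- `M` is an admissible set of omitted points of the star configuration of type `t`:
a set of `b` intersection points of pairs of lines (indexed by pairs `i < j`), such that every
line contains at most one of them. -/
def TraceType.IsOmittedSet (t : TraceType) (M : Finset (Fin t.starLines × Fin t.starLines)) :
    Prop :=
  M.card = t.omitted ∧ (∀ x ∈ M, x.1 < x.2) ∧
    ∀ l : Fin t.starLines, ∀ x ∈ M, ∀ y ∈ M,
      (x.1 = l ∨ x.2 = l) → (y.1 = l ∨ y.2 = l) → x = y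

/-- The ideal of the trace scheme of type `t` with coordinates `v` and omitted set `M`:
the scheme-theoretic union of all its components. -/
noncomputable def TraceType.ideal {K : Type*} [Field K] (t : TraceType)
    (M : Finset (Fin t.starLines × Fin t.starLines)) (v : t.Coord → K) :
    Ideal (MvPolynomial (Fin 3) K) :=
  (⨅ i, lineIdeal fun c => v (.line i c)) ⊓
  (⨅ i, doublePointIdeal fun c => v (.double i c)) ⊓
  (⨅ i, lengthTwoIdeal (fun c => v (.support i c)) (fun c => v (.direction i c))) ⊓
  (⨅ i, ⨅ j, ⨅ _ : i < j ∧ (i, j) ∉ M,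
    pointIdeal (crossProduct (fun c => v (.star i c)) (fun c => v (.star j c)))) ⊓
  (⨅ i, pointIdeal fun c => v (.point i c)) ⊓
  (⨅ i, pointIdeal fun c =>
    v (.collinear i 0) * v (.base 0 c) + v (.collinear i 1) * v (.base 1 c))

/-- `P` holds for general `v`: for all `v` in some nonempty basic Zariski open subset. -/
def HoldsGenerically {K ι : Type*} [Field K] (P : (ι → K) → Prop) : Prop :=
  ∃ G : MvPolynomial ι K, G ≠ 0 ∧ ∀ v : ι → K, MvPolynomial.eval v G ≠ 0 → P v

/-- `t` is the type `T(e, s, m, (a, b), p)` with `q` additional collinear points.  The entries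
are compared in `ℚ`, so all of `e, s, m, a, b, p, q` are forced to be nonnegative integers. -/
def TraceType.Is (t : TraceType) (e s m a b p q : ℚ) : Prop :=
  (t.lines : ℚ) = e ∧ (t.doubles : ℚ) = s ∧ (t.lengthTwos : ℚ) = m ∧ (t.starLines : ℚ) = a ∧
    (t.omitted : ℚ) = b ∧ (t.points : ℚ) = p ∧ (t.collinear : ℚ) = q

/-- The types of the trace schemes which appear in the reduction steps with parameter `k`. -/
inductive IsReductionTrace (k : ℕ) (t : TraceType) : Prop
  /-- degree `3k`, `k` odd -/
  | red_odd₀ : Odd k → t.Is (k + 1) 0 (k * (k - 1) / 2 - 2) (k + 1) ((k + 1) / 2)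
      ((k ^ 2 + 4 * k + 9) / 2) 0 → IsReductionTrace k t
  /-- degree `3k - 1`, `k` odd -/
  | red_odd₁ : Odd k → t.Is k 3 ((k ^ 2 - 1) / 2 - k - 2) (k + 1) 2
      (k * (k + 5) / 2 - 2) 0 → IsReductionTrace k t
  /-- degree `3k - 2`, `k` odd -/
  | red_odd₂ : Odd k → t.Is k ((k + 1) / 2) (k * (k - 3) / 2) k ((k - 1) / 2)
      (k * (k + 3) / 2 - 2) 0 → IsReductionTrace k t
  /-- degree `3k`, `k` even -/
  | red_even₀ : Even k → t.Is (k + 1) 0 (k * (k - 1) / 2 - 1) (k + 1) (k / 2)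
      ((k + 2) ^ 2 / 2) 0 → IsReductionTrace k t
  /-- degree `3k - 1`, `k` even -/
  | red_even₁ : Even k → t.Is k 1 (k * (k - 2) / 2 - 1) (k + 1) 1
      (k * (k + 5) / 2) 0 → IsReductionTrace k t
  /-- degree `3k - 2`, `k` even -/
  | red_even₂ : Even k → t.Is k (k / 2) (k * (k - 3) / 2) k (k / 2)
      (k * (k + 3) / 2) 0 → IsReductionTrace k t
  /-- initial degree `3k`, first step -/
  | init₀ : t.Is (k + 1) (k * (k - 1) / 2) 0 0 0
      (k * (k + 5) / 2) 0 → IsReductionTrace k t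
  /-- initial degree `3k`, second step, `k` odd -/
  | init₀_odd : Odd k → t.Is k 1 ((k ^ 2 - 2 * k - 1) / 2) (k + 1) 0
      (k * (k + 5) / 2 - 2) 0 → IsReductionTrace k t
  /-- initial degree `3k`, second step, `k` even -/
  | init₀_even : Even k → t.Is k 0 (k * (k - 2) / 2) (k + 1) 0
      (k * (k + 5) / 2) 0 → IsReductionTrace k t
  /-- initial degree `3k + 1`, first step -/
  | init₁ : t.Is (k + 2) (k * (k - 3) / 2) 0 0 0
      (k * (k + 11) / 2) 0 → IsReductionTrace k t
  /-- initial degree `3k + 1`, second step, `k` odd -/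
  | init₁_odd : Odd k → t.Is k 1 ((k ^ 2 - 4 * k - 1) / 2) (k + 2) 0
      (k * (k + 11) / 2 - 2) 0 → IsReductionTrace k t
  /-- initial degree `3k + 1`, third step, `k` odd -/
  | init₁_odd' : Odd k → t.Is k ((3 * k + 1) / 2) (k * (k - 5) / 2) k ((k - 1) / 2)
      (k * (k + 5) / 2 - 2) 0 → IsReductionTrace k t
  /-- initial degree `3k + 1`, second step, `k` even -/
  | init₁_even : Even k → t.Is k 0 (k * (k - 4) / 2) (k + 2) 0
      (k * (k + 11) / 2) 0 → IsReductionTrace k t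
  /-- initial degree `3k + 1`, third step, `k` even -/
  | init₁_even' : Even k → t.Is k (3 * k / 2) (k * (k - 5) / 2) k (k / 2)
      (k * (k + 5) / 2) 0 → IsReductionTrace k t
  /-- initial degree `3k + 2`, first step, with `k + 1` collinear points -/
  | init₂ : t.Is (k + 2) (k * (k - 3) / 2 - 1) 0 0 0
      (k * (k + 13) / 2 + 3) (k + 1) → IsReductionTrace k t
  /-- initial degree `3k + 2`, second step, `k` odd -/
  | init₂_odd : Odd k → t.Is k (k + 2) ((k ^ 2 - 4 * k - 3) / 2) (k + 2) 0
      (k * (k + 9) / 2 - 1) 0 → IsReductionTrace k t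
  /-- initial degree `3k + 2`, third step, `k` odd -/
  | init₂_odd' : Odd k → t.Is (k + 1) ((k - 1) / 2) ((k ^ 2 + 1) / 2 - k - 2) k ((k - 1) / 2)
      (k * (k + 5) / 2 + 4) 0 → IsReductionTrace k t
  /-- initial degree `3k + 2`, second step, `k` even -/
  | init₂_even : Even k → t.Is k (k + 1) (k * (k - 4) / 2 - 1) (k + 2) 0
      (k * (k + 9) / 2 + 1) 0 → IsReductionTrace k t
  /-- initial degree `3k + 2`, third step, `k` even -/
  | init₂_even' : Even k → t.Is (k + 1) (k / 2) (k * (k - 2) / 2 - 1) k (k / 2)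
      (k * (k + 5) / 2 + 2) 0 → IsReductionTrace k t

open MvPolynomial

/-! Each scheme is the union of `e` lines with product `F` and a zero-dimensional scheme `Z`. The
numbers are arranged so that the length of `Z` is exactly the dimension of the forms of some degree
`δ`. If `Z` imposes independent conditions in degree `δ`, then no nonzero form of degree at most `δ`
contains `Z`, and forms of every degree at least `δ` restrict onto `Z`. When the lines miss the
support of `Z`, a form vanishing on the union is `F` times a form vanishing on `Z`. Hence
restriction is injective for `d ≤ e + δ`. For larger `d`, a section is first lifted from the lines,
and the lift is then corrected at `Z` by a multiple of `F`. This is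
`goodPostulation_iInf_lineIdeal_inf`; it works with the sections over the charts `X 0 ≠ 0` and `X 1
≠ 0`, which cover the union because the lines avoid (0:0:1) and `Z` avoids `X 0 = 0`.

Independence is the nonvanishing of a determinant that is polynomial in the coordinates, so one
special position suffices (`holdsGenerically_surjective`). Take `k` lines dual to points of a conic,
no three of them concurrent, and place the double points and the length 2 schemes at distinct nodes
of this arrangement. The squared product of the `k - 2` lines missing a node is singular at every
other node and nonzero at that one; one more linear factor isolates a derivative. The product of all
`k` lines is singular at every node, and further linear factors separate the star points, or the
collinear points. These dual forms make the system of conditions triangular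
(`exists_form_dual_condition`, `exists_eq_of_triangular`). The general points are added one at a
time (`exists_points`). What remains is arithmetic: a length count, a bound on the number of nodes
and two degree bounds. -/

/-- The value of a polynomial at `P`, or its derivative at `P` in the direction `w`. -/
noncomputable def jet (K : Type*) [Field K] {R : Type*} [CommRing R] [Algebra K R] (P : Fin 3 → R) :
    Option (Fin 3 → R) → MvPolynomial (Fin 3) K →ₗ[K] R
  | none => (aeval P).toLinearMap
  | some w => ∑ c, LinearMap.mulLeft K (w c) ∘ₗ (aeval P).toLinearMap ∘ₗ
      ((pderiv c : Derivation K (MvPolynomial (Fin 3) K) _) : MvPolynomial (Fin 3) K →ₗ[K] _)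

/-! ### Calculus of first-order jets. -/

section Jet

variable {K : Type*} [Field K] {R : Type*} [CommRing R] [Algebra K R]

theorem jet_none (P : Fin 3 → R) (f : MvPolynomial (Fin 3) K) : jet K P none f = aeval P f := rfl

theorem jet_some (P w : Fin 3 → R) (f : MvPolynomial (Fin 3) K) :
    jet K P (some w) f = ∑ c, w c * aeval P (pderiv c f) := by
  simp [jet, LinearMap.sum_apply]

theorem jet_some_mul (P w : Fin 3 → R) (f g : MvPolynomial (Fin 3) K) :
    jet K P (some w) (f * g) =
      jet K P (some w) f * aeval P g + aeval P f * jet K P (some w) g := by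
  simp only [jet_some, pderiv_mul, map_add, map_mul, Finset.sum_mul, Finset.mul_sum,
    ← Finset.sum_add_distrib]
  exact Finset.sum_congr rfl fun _ _ => by ring

theorem jet_map {S : Type*} [CommRing S] [Algebra K S] (φ : R →ₐ[K] S) (P : Fin 3 → R)
    (o : Option (Fin 3 → R)) (f : MvPolynomial (Fin 3) K) :
    φ (jet K P o f) = jet K (fun c => φ (P c)) (o.map fun w c => φ (w c)) f := by
  have h (g : MvPolynomial (Fin 3) K) : φ (aeval P g) = aeval (fun c => φ (P c)) g := by
    rw [← AlgHom.comp_apply, comp_aeval]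
  cases o with
  | none => exact h f
  | some w => simp [jet_some, h]

/-- Leibniz rule: jets of a product vanish when the jets of one factor do. -/
theorem jet_mul_eq_zero {P : Fin 3 → R} {o : Option (Fin 3 → R)} (g : MvPolynomial (Fin 3) K)
    {f : MvPolynomial (Fin 3) K} (h0 : jet K P none f = 0) (h : jet K P o f = 0) :
    jet K P o (g * f) = 0 := by
  rw [jet_none] at h0
  cases o with
  | none => simp [jet_none, h0]
  | some w => simp [jet_some_mul, h0, h]

theorem jet_mul_eq_zero_of_aeval {P : Fin 3 → R} (o : Option (Fin 3 → R))
    {f g : MvPolynomial (Fin 3) K} (hf : aeval P f = 0) (hg : aeval P g = 0) :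
    jet K P o (f * g) = 0 := by
  cases o with
  | none => simp [jet_none, hf]
  | some w => simp [jet_some_mul, hf, hg]

theorem aeval_lineForm (P : Fin 3 → R) (v : Fin 3 → K) :
    aeval P (lineForm v) = ∑ c, algebraMap K R (v c) * P c := by
  simp [lineForm]

theorem pderiv_lineForm (v : Fin 3 → K) (c : Fin 3) : pderiv c (lineForm v) = C (v c) := by
  simp [lineForm, Derivation.leibniz, pderiv_X, Pi.single_apply]

theorem isHomogeneous_lineForm (v : Fin 3 → K) : (lineForm v).IsHomogeneous 1 :=
  IsHomogeneous.sum _ _ _ fun i _ => by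
    simpa using (isHomogeneous_C (Fin 3) (v i)).mul (isHomogeneous_X K i)

end Jet

/-! ### Membership in the ideals of fat points, expressed by jets. -/

section Local

variable {K : Type*} [Field K]

/-- Taylor expansion of order one. -/
theorem taylor_mem {σ A : Type*} [Fintype σ] [CommRing A] [Algebra K A] (y h : σ → A)
    (I : Ideal A) (hI : ∀ i, h i ∈ I) (f : MvPolynomial σ K) :
    aeval (fun i => y i + h i) f - (aeval y f + ∑ i, h i * aeval y (pderiv i f)) ∈ I ^ 2 := by
  classical
  induction f using MvPolynomial.induction_on with
  | C a => simp
  | add p q hp hq =>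
    convert Ideal.add_mem _ hp hq using 1
    simp only [map_add, mul_add, Finset.sum_add_distrib]
    ring
  | mul_X p j hp =>
    have h1 : (∑ i, h i * aeval y (pderiv i p)) * h j ∈ I ^ 2 := by
      rw [pow_two]
      exact Ideal.mul_mem_mul (Ideal.sum_mem _ fun i _ => Ideal.mul_mem_right _ _ (hI i)) (hI j)
    convert Ideal.add_mem _ (Ideal.mul_mem_right (y j + h j) _ hp) h1 using 1
    have h2 : ∑ i, h i * aeval y (pderiv i (p * X j)) =
        (∑ i, h i * aeval y (pderiv i p)) * y j + aeval y p * h j := by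
      simp only [pderiv_mul, pderiv_X, map_add, map_mul, aeval_X, mul_add, Finset.sum_add_distrib,
        Finset.sum_mul]
      congr 1
      · exact Finset.sum_congr rfl fun _ _ => by ring
      · rw [Finset.sum_eq_single j (fun i _ hij => by simp [hij.symm])] <;> simp [mul_comm]
    rw [h2]
    simp only [map_mul, aeval_X]
    ring

theorem aeval_smul_of_isHomogeneous {σ A : Type*} [CommRing A] [Algebra K A] {n : ℕ}
    {f : MvPolynomial σ K} (hf : f.IsHomogeneous n) (r : A) (y : σ → A) :
    aeval (fun i => r * y i) f = r ^ n * aeval y f := by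
  rw [aeval_def, aeval_def, eval₂_eq, eval₂_eq, Finset.mul_sum]
  refine Finset.sum_congr rfl fun d hd => ?_
  have : ∑ i ∈ d.support, d i = n := (hf.degree_eq_sum_deg_support hd).symm
  simp only [mul_pow, Finset.prod_mul_distrib, Finset.prod_pow_eq_pow_sum, this]
  ring

variable {P : Fin 3 → K}

theorem X_sub_mem_pointIdeal (hP : P 0 ≠ 0) (i : Fin 3) :
    (X i - C (P 0)⁻¹ * X 0 * C (P i) : MvPolynomial (Fin 3) K) ∈ pointIdeal P := by
  have h : C (P 0) * X i - C (P i) * X 0 ∈ pointIdeal P := Ideal.subset_span ⟨(0, i), rfl⟩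
  convert Ideal.mul_mem_left _ (C (P 0)⁻¹) h using 1
  have : (C (P 0)⁻¹ * C (P 0) : MvPolynomial (Fin 3) K) = 1 := by
    rw [← C_mul, inv_mul_cancel₀ hP, C_1]
  linear_combination -X i * this

/-- Homogeneous Taylor expansion at the point `P`. -/
theorem sub_taylor_mem_doublePointIdeal (hP : P 0 ≠ 0) {n : ℕ} {f : MvPolynomial (Fin 3) K}
    (hf : f.IsHomogeneous n) :
    f - ((C (P 0)⁻¹ * X 0) ^ n * C (aeval P f) + ∑ i, (X i - C (P 0)⁻¹ * X 0 * C (P i)) *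
      ((C (P 0)⁻¹ * X 0) ^ (n - 1) * C (aeval P (pderiv i f)))) ∈ doublePointIdeal P := by
  -- Expand around `(X 0 / P 0) • P`, the multiple of `P` with the same coordinate 0 as the generic
  -- point: the increments then lie in the ideal of the point.
  have key := taylor_mem (K := K) (fun i => C (P 0)⁻¹ * X 0 * C (P i))
    (fun i => X i - C (P 0)⁻¹ * X 0 * C (P i)) _ (X_sub_mem_pointIdeal hP) f
  have hC (g : MvPolynomial (Fin 3) K) :
      aeval (fun i => (C (P i) : MvPolynomial (Fin 3) K)) g = C (aeval P g) := by
    exact aeval_algebraMap_apply (MvPolynomial (Fin 3) K) P g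
  simp only [add_sub_cancel, aeval_X_left, AlgHom.id_apply, aeval_smul_of_isHomogeneous hf,
    aeval_smul_of_isHomogeneous (hf.pderiv), hC] at key
  exact key

theorem aeval_eq_zero_of_mem_pointIdeal {f : MvPolynomial (Fin 3) K} (hf : f ∈ pointIdeal P) :
    aeval P f = 0 := by
  have : pointIdeal P ≤ RingHom.ker (aeval P : MvPolynomial (Fin 3) K →ₐ[K] K) := by
    refine Ideal.span_le.2 ?_
    rintro _ ⟨⟨i, j⟩, rfl⟩
    simp [RingHom.mem_ker, mul_comm]
  exact this hf

theorem jet_eq_zero_of_mem_doublePointIdeal {f : MvPolynomial (Fin 3) K}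
    (hf : f ∈ doublePointIdeal P) (o : Option (Fin 3 → K)) : jet K P o f = 0 := by
  rw [doublePointIdeal, pow_two] at hf
  refine Submodule.mul_induction_on hf (fun a ha b hb => ?_) fun a b ha hb => ?_
  · exact jet_mul_eq_zero_of_aeval o (aeval_eq_zero_of_mem_pointIdeal ha)
      (aeval_eq_zero_of_mem_pointIdeal hb)
  · rw [map_add, ha, hb, add_zero]

theorem mem_pointIdeal_iff (hP : P 0 ≠ 0) {n : ℕ} {f : MvPolynomial (Fin 3) K}
    (hf : f.IsHomogeneous n) : f ∈ pointIdeal P ↔ aeval P f = 0 := by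
  refine ⟨aeval_eq_zero_of_mem_pointIdeal, fun h => ?_⟩
  have key := Ideal.pow_le_self two_ne_zero (sub_taylor_mem_doublePointIdeal hP hf)
  rw [h, C_0, mul_zero, zero_add] at key
  exact (Submodule.sub_mem_iff_left _ (Ideal.sum_mem _ fun i _ =>
    Ideal.mul_mem_right _ _ (X_sub_mem_pointIdeal hP i))).1 key

/-- Euler's relation: the sum is `n` times the value at `P`. Since that value is zero, no assumption
on the characteristic is needed. -/
theorem sum_mul_aeval_pderiv {n : ℕ} {f : MvPolynomial (Fin 3) K}
    (hf : f.IsHomogeneous n) (h : aeval P f = 0) : ∑ i, P i * aeval P (pderiv i f) = 0 := by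
  have e := congrArg (aeval P) hf.sum_X_mul_pderiv
  rw [map_nsmul, h, smul_zero, map_sum] at e
  simpa only [map_mul, aeval_X] using e

/-- Modulo the ideal of the double point, a form vanishing at `P` is its differential at `P` times
a power of a linear form. -/
theorem sub_differential_mem_doublePointIdeal (hP : P 0 ≠ 0) {n : ℕ}
    {f : MvPolynomial (Fin 3) K} (hf : f.IsHomogeneous n) (h : aeval P f = 0) :
    f - lineForm (fun i => aeval P (pderiv i f)) * (C (P 0)⁻¹ * X 0) ^ (n - 1) ∈
      doublePointIdeal P := by
  convert sub_taylor_mem_doublePointIdeal hP hf using 2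
  have e := congrArg (C : K →+* MvPolynomial (Fin 3) K) (sum_mul_aeval_pderiv hf h)
  simp only [h, lineForm, Fin.sum_univ_three, C_0, C_add, C_mul] at e ⊢
  linear_combination (C (P 0)⁻¹ * X 0) ^ (n - 1) * (C (P 0)⁻¹ * X 0) * e

/-- Two of the three partial derivatives are enough: as `P 0 ≠ 0`, Euler's relation recovers the
remaining one. Thus a double point gives exactly three conditions. -/
theorem mem_doublePointIdeal_iff (hP : P 0 ≠ 0) {n : ℕ} {f : MvPolynomial (Fin 3) K}
    (hf : f.IsHomogeneous n) :
    f ∈ doublePointIdeal P ↔ aeval P f = 0 ∧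
      ∀ d : Fin 2, jet K P (some (Pi.single d.succ 1)) f = 0 := by
  refine ⟨fun h => ⟨jet_eq_zero_of_mem_doublePointIdeal h none,
    fun _ => jet_eq_zero_of_mem_doublePointIdeal h _⟩, ?_⟩
  rintro ⟨h, h12⟩
  have e := sum_mul_aeval_pderiv hf h
  have hd (c : Fin 3) : jet K P (some (Pi.single c 1)) f = aeval P (pderiv c f) := by
    simp [jet_some, Pi.single_apply]
  have h1 := (hd 1).symm.trans (h12 0)
  have h2 := (hd 2).symm.trans (h12 1)
  simp only [Fin.sum_univ_three] at e
  have h0 : aeval P (pderiv 0 f) = 0 := by simpa [h1, h2, hP] using e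
  have key := sub_differential_mem_doublePointIdeal hP hf h
  simpa only [lineForm, Fin.sum_univ_three, h0, h1, h2, C_0, zero_mul, add_zero, sub_zero] using key

/-- The differential of `f` at `P` is orthogonal to `P` by Euler and to `Q` by assumption, hence
proportional to `P × Q`. Modulo the double point, `f` is therefore a multiple of the equation of the
line `PQ`. -/
theorem mem_lengthTwoIdeal_iff {Q : Fin 3 → K} (hP : P 0 ≠ 0) (hPQ : crossProduct P Q 2 ≠ 0)
    {n : ℕ} {f : MvPolynomial (Fin 3) K} (hf : f.IsHomogeneous n) :
    f ∈ lengthTwoIdeal P Q ↔ aeval P f = 0 ∧ jet K P (some Q) f = 0 := by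
  constructor
  · intro h
    obtain ⟨a, ha, b, hb, rfl⟩ := Submodule.mem_sup.1 h
    obtain ⟨c, rfl⟩ := Ideal.mem_span_singleton.1 hb
    have h0 : aeval P (lineForm (crossProduct P Q)) = 0 := by
      simp only [aeval_lineForm, cross_apply, Fin.sum_univ_three, Matrix.cons_val,
        Algebra.algebraMap_self, RingHom.id_apply]
      ring
    have h1 : jet K P (some Q) (lineForm (crossProduct P Q)) = 0 := by
      simp only [jet_some, pderiv_lineForm, aeval_C, cross_apply, Fin.sum_univ_three,
        Matrix.cons_val, Algebra.algebraMap_self, RingHom.id_apply]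
      ring
    rw [mul_comm]
    have key (o) (ho : jet K P o (lineForm (crossProduct P Q)) = 0) :
        jet K P o (a + c * lineForm (crossProduct P Q)) = 0 := by
      rw [map_add, jet_eq_zero_of_mem_doublePointIdeal ha, jet_mul_eq_zero c h0 ho, add_zero]
    exact ⟨key none h0, key _ h1⟩
  · rintro ⟨h, h1⟩
    have e := sum_mul_aeval_pderiv hf h
    rw [jet_some] at h1
    set w : Fin 3 → K := fun i => aeval P (pderiv i f) with hw
    have hw' : w = (w 2 / crossProduct P Q 2) • crossProduct P Q := by
      change ∑ i, P i * w i = 0 at e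
      change ∑ i, Q i * w i = 0 at h1
      simp only [Fin.sum_univ_three] at e h1
      have hΔ : P 0 * Q 1 - P 1 * Q 0 ≠ 0 := by simpa [cross_apply] using hPQ
      funext i
      fin_cases i <;>
        simp only [cross_apply, Fin.zero_eta, Fin.mk_one, Fin.reduceFinMk, Pi.smul_apply,
          Matrix.cons_val, smul_eq_mul] <;> field_simp
      · linear_combination Q 1 * e - P 1 * h1
      · linear_combination P 0 * h1 - Q 0 * e
    have key := sub_differential_mem_doublePointIdeal hP hf h
    rw [← sub_add_cancel f (lineForm w * (C (P 0)⁻¹ * X 0) ^ (n - 1))]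
    refine Ideal.add_mem _ (Ideal.mem_sup_left key) (Ideal.mem_sup_right ?_)
    refine Ideal.mul_mem_right _ _ ?_
    rw [hw', lineIdeal, Ideal.mem_span_singleton]
    refine ⟨C (w 2 / crossProduct P Q 2), ?_⟩
    simp only [lineForm, Finset.sum_mul, Pi.smul_apply, smul_eq_mul, C_mul]
    exact Finset.sum_congr rfl fun _ _ => by ring

end Local

/-! ### Homogeneous components, dimension of spaces of forms, coprimality of linear forms. -/

section Forms

variable {K : Type*} [Field K]

theorem homogeneousComponent_mul_of_isHomogeneous {σ : Type*} {m : ℕ} {F : MvPolynomial σ K}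
    (hF : F.IsHomogeneous m) (g : MvPolynomial σ K) (j : ℕ) :
    homogeneousComponent (m + j) (F * g) = F * homogeneousComponent j g := by
  conv_lhs => rw [← sum_homogeneousComponent g, Finset.mul_sum, map_sum]
  have h (i : ℕ) : homogeneousComponent (m + j) (F * homogeneousComponent i g) =
      if i = j then F * homogeneousComponent i g else 0 := by
    rw [homogeneousComponent_of_mem (m := m + j) (n := m + i)
      (hF.mul (homogeneousComponent_isHomogeneous i g))]
    simp [eq_comm]
  rw [Finset.sum_congr rfl fun i _ => h i, Finset.sum_ite_eq']
  split_ifs with hj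
  · rfl
  · rw [homogeneousComponent_eq_zero _ _ (by simpa using hj), mul_zero]

theorem finrank_homogeneousSubmodule (σ : Type*) [Fintype σ] (n : ℕ) :
    Module.finrank K (homogeneousSubmodule σ K n) = (Fintype.card σ + n - 1).choose n := by
  classical
  have hs : {d : σ →₀ ℕ | d.degree = n} = (Finset.univ.finsuppAntidiag n : Finset (σ →₀ ℕ)) := by
    ext d
    simp [Finset.mem_finsuppAntidiag, Finsupp.degree_eq_sum]
  rw [homogeneousSubmodule_eq_finsupp_supported, hs]
  refine (Module.finrank_eq_nat_card_basis (basisRestrictSupport K _)).trans ?_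
  rw [Nat.card_coe_set_eq, Set.ncard_coe_finset, Finset.card_finsuppAntidiag_nat_eq_choose,
    Finset.card_univ]

instance finite_homogeneousSubmodule (σ : Type*) [Finite σ] (n : ℕ) :
    Module.Finite K (homogeneousSubmodule σ K n) :=
  Module.Finite.iff_fg.2 (homogeneousSubmodule_fg σ K n)

/-- A linear form with nonzero last coefficient is a nonzerodivisor modulo powers of the other two
coordinates. -/
theorem mem_of_lineForm_mul_mem {v : Fin 3 → K} (hv : v 2 ≠ 0) (n m : ℕ)
    {h : MvPolynomial (Fin 3) K}
    (hh : lineForm v * h ∈ Ideal.span {(X 0 ^ n : MvPolynomial (Fin 3) K), X 1 ^ m}) :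
    h ∈ Ideal.span {(X 0 ^ n : MvPolynomial (Fin 3) K), X 1 ^ m} := by
  set I := Ideal.span {(X 0 ^ n : MvPolynomial (Fin 3) K), X 1 ^ m} with hI
  have hI' : I = Ideal.span ((fun s => monomial s (1 : K)) ''
      {Finsupp.single (0 : Fin 3) n, Finsupp.single (1 : Fin 3) m}) := by
    rw [hI, Set.image_pair, X_pow_eq_monomial, X_pow_eq_monomial]
  -- The generators are monomials without `X 2`, so powers of `X 2` can be cancelled.
  have hX (r : ℕ) (g : MvPolynomial (Fin 3) K) (hg : X 2 ^ r * g ∈ I) : g ∈ I := by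
    rw [hI', mem_ideal_span_monomial_image] at hg ⊢
    intro d hd
    have hd' : d + Finsupp.single 2 r ∈ (X 2 ^ r * g).support := by
      rw [mem_support_iff, X_pow_eq_monomial, add_comm, coeff_monomial_mul, one_mul]
      exact mem_support_iff.1 hd
    obtain ⟨s, hs, hle⟩ := hg _ hd'
    refine ⟨s, hs, fun i => ?_⟩
    have := hle i
    rcases hs with rfl | rfl <;> fin_cases i <;> simp_all
  set N : MvPolynomial (Fin 3) K := -(C (v 0) * X 0 + C (v 1) * X 1) with hN
  have hNr : N ^ (n + m) ∈ I := by
    have := Ideal.add_pow_add_pred_mem_of_pow_mem I (a := C (v 0) * X 0) (b := C (v 1) * X 1)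
      (m := n) (n := m)
      (by rw [mul_pow]; exact Ideal.mul_mem_left _ _ (Ideal.subset_span (by simp)))
      (by rw [mul_pow]; exact Ideal.mul_mem_left _ _ (Ideal.subset_span (by simp)))
    rw [hN, neg_pow]
    exact Ideal.mul_mem_left _ _ (Ideal.pow_mem_of_pow_mem _ this (by omega))
  have hL : lineForm v = C (v 2) * X 2 - N := by
    simp only [lineForm, Fin.sum_univ_three, hN]
    ring
  -- Modulo the linear form, `v 2 * X 2` equals `N`, which is nilpotent modulo `I`; comparing powers
  -- replaces the linear form by a power of `X 2`.
  obtain ⟨q, hq⟩ := sub_dvd_pow_sub_pow (C (v 2) * X 2) N (n + m)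
  have h1 : (C (v 2) * X 2) ^ (n + m) * h ∈ I := by
    have e : (C (v 2) * X 2) ^ (n + m) * h = q * (lineForm v * h) + h * N ^ (n + m) := by
      rw [hL]
      linear_combination h * hq
    rw [e]
    exact Ideal.add_mem _ (Ideal.mul_mem_left _ _ hh) (Ideal.mul_mem_left _ _ hNr)
  refine hX (n + m) h ?_
  convert Ideal.mul_mem_left _ (C ((v 2)⁻¹) ^ (n + m)) h1 using 1
  have : (C ((v 2)⁻¹) ^ (n + m) * C (v 2) ^ (n + m) : MvPolynomial (Fin 3) K) = 1 := by
    rw [← mul_pow, ← C_mul, inv_mul_cancel₀ hv, C_1, one_pow]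
  rw [mul_pow]
  linear_combination -(X 2 ^ (n + m) * h) * this

theorem mem_of_prod_lineForm_mul_mem {ι : Type*} (s : Finset ι) {v : ι → Fin 3 → K}
    (hv : ∀ i, v i 2 ≠ 0) (n m : ℕ) {h : MvPolynomial (Fin 3) K}
    (hh : (∏ i ∈ s, lineForm (v i)) * h ∈
      Ideal.span {(X 0 ^ n : MvPolynomial (Fin 3) K), X 1 ^ m}) :
    h ∈ Ideal.span {(X 0 ^ n : MvPolynomial (Fin 3) K), X 1 ^ m} := by
  classical
  induction s using Finset.induction_on generalizing h with
  | empty => simpa using hh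
  | insert i s hi ih =>
    rw [Finset.prod_insert hi, mul_assoc] at hh
    exact ih (mem_of_lineForm_mul_mem (hv i) n m hh)

theorem coeff_lineForm (v : Fin 3 → K) (i : Fin 3) :
    coeff (Finsupp.single i 1) (lineForm v) = v i := by
  simp only [lineForm, coeff_sum, coeff_C_mul]
  rw [Finset.sum_eq_single i] <;> simp +contextual [coeff_X, Finsupp.single_left_inj]

theorem lineForm_ne_zero {v : Fin 3 → K} {i : Fin 3} (hv : v i ≠ 0) : lineForm v ≠ 0 := by
  intro h
  apply hv
  rw [← coeff_lineForm v i, h, coeff_zero]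

theorem exists_C_mul_of_lineForm_mul {v : Fin 3 → K} {i : Fin 3} (hv : v i ≠ 0) {a b : MvPolynomial (Fin 3) K}
    (h : lineForm v = a * b) : ∃ c ≠ 0, a = C c ∨ b = C c := by
  have ha : a ≠ 0 := by rintro rfl; exact lineForm_ne_zero hv (by simpa using h)
  have hb : b ≠ 0 := by rintro rfl; exact lineForm_ne_zero hv (by simpa using h)
  have hd := (isHomogeneous_lineForm v).totalDegree (lineForm_ne_zero hv)
  rw [h, totalDegree_mul_of_isDomain ha hb] at hd
  rcases Nat.eq_zero_or_pos a.totalDegree with h0 | h0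
  · rw [totalDegree_eq_zero_iff_eq_C] at h0
    exact ⟨_, fun h1 => ha (by rw [h0, h1, C_0]), Or.inl h0⟩
  · have h0 : b.totalDegree = 0 := by omega
    rw [totalDegree_eq_zero_iff_eq_C] at h0
    exact ⟨_, fun h1 => hb (by rw [h0, h1, C_0]), Or.inr h0⟩

theorem irreducible_lineForm {v : Fin 3 → K} {i : Fin 3} (hv : v i ≠ 0) : Irreducible (lineForm v) := by
  refine ⟨fun h => ?_, fun a b h => ?_⟩
  · have := (MvPolynomial.isUnit_iff_totalDegree_of_isReduced.1 h).2
    rw [(isHomogeneous_lineForm v).totalDegree (lineForm_ne_zero hv)] at this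
    exact one_ne_zero this
  · obtain ⟨c, hc, rfl | rfl⟩ := exists_C_mul_of_lineForm_mul hv h
    · exact Or.inl ((isUnit_iff_ne_zero.2 hc).map C)
    · exact Or.inr ((isUnit_iff_ne_zero.2 hc).map C)

theorem eq_smul_of_associated_lineForm {v w : Fin 3 → K}
    (h : Associated (lineForm v) (lineForm w)) : ∃ c : K, w = c • v := by
  obtain ⟨u, hu⟩ := h
  have := (MvPolynomial.isUnit_iff_totalDegree_of_isReduced.1 u.isUnit).2
  rw [totalDegree_eq_zero_iff_eq_C] at this
  refine ⟨coeff 0 (u : MvPolynomial (Fin 3) K), funext fun i => ?_⟩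
  rw [← coeff_lineForm w i, ← hu, this, mul_comm, coeff_C_mul, coeff_lineForm]
  simp

theorem isRelPrime_lineForm {v w : Fin 3 → K} {i j : Fin 3} (hv : v i ≠ 0) (hw : w j ≠ 0)
    (h : ∀ c : K, w ≠ c • v) : IsRelPrime (lineForm v) (lineForm w) := by
  rw [(irreducible_lineForm hv).isRelPrime_iff_not_dvd,
    (irreducible_lineForm hv).dvd_irreducible_iff_associated (irreducible_lineForm hw)]
  intro ha
  obtain ⟨c, hc⟩ := eq_smul_of_associated_lineForm ha
  exact h c hc

theorem isRelPrime_X_lineForm {v : Fin 3 → K} (hv : v 2 ≠ 0) {i : Fin 3} (hi : i ≠ 2) :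
    IsRelPrime (X i) (lineForm v) := by
  have hX : (X i : MvPolynomial (Fin 3) K) = lineForm (Pi.single i 1) := by
    simp [lineForm, Pi.single_apply]
  rw [hX]
  refine isRelPrime_lineForm (i := i) (by simp) hv fun c hc => hv ?_
  rw [hc]
  simp [hi.symm]

end Forms

/-! ### Restriction maps computed on charts. -/

section Sections

variable {K : Type*} [Field K] {N : ℕ} {I : Ideal (MvPolynomial (Fin (N + 1)) K)}

theorem algebraMap_away_eq_iff {i : Fin (N + 1)} {f g : MvPolynomial (Fin (N + 1)) K} :
    algebraMap _ (coordAway I i) (Ideal.Quotient.mk I f) =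
      algebraMap _ (coordAway I i) (Ideal.Quotient.mk I g) ↔ ∃ n, X i ^ n * (f - g) ∈ I := by
  rw [IsLocalization.eq_iff_exists (Submonoid.powers (Ideal.Quotient.mk I (X i)))]
  simp only [Subtype.exists, Submonoid.mem_powers_iff, exists_prop, exists_exists_eq_and,
    ← map_pow, ← map_mul, Ideal.Quotient.eq, mul_sub]

theorem algebraMap_away₂_eq_iff {i j : Fin (N + 1)} {f g : MvPolynomial (Fin (N + 1)) K} :
    algebraMap _ (coordAway₂ I i j) (Ideal.Quotient.mk I f) =
      algebraMap _ (coordAway₂ I i j) (Ideal.Quotient.mk I g) ↔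
        ∃ n, (X i * X j) ^ n * (f - g) ∈ I := by
  rw [IsLocalization.eq_iff_exists
    (Submonoid.powers (Ideal.Quotient.mk I (X i) * Ideal.Quotient.mk I (X j)))]
  simp only [Subtype.exists, Submonoid.mem_powers_iff, exists_prop, exists_exists_eq_and,
    ← map_mul, ← map_pow, Ideal.Quotient.eq, mul_sub]

theorem restrictionMap_apply {d : ℕ} (f : homogeneousSubmodule (Fin (N + 1)) K d)
    (i : Fin (N + 1)) : (restrictionMap I d f).1 i =
      algebraMap _ (coordAway I i) (Ideal.Quotient.mk I (f : MvPolynomial (Fin (N + 1)) K)) := rfl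

theorem pow_X_mul_mem (i : Fin (N + 1))
    (hI : ∀ n f, f.IsHomogeneous n → X i * f ∈ I → f ∈ I) (r : ℕ) {n : ℕ}
    {f : MvPolynomial (Fin (N + 1)) K} (hf : f.IsHomogeneous n) (h : X i ^ r * f ∈ I) : f ∈ I := by
  induction r with
  | zero => simpa using h
  | succ r ih =>
    refine ih (hI _ _ ((isHomogeneous_X_pow i r).mul hf) ?_)
    rwa [← mul_assoc, ← pow_succ']

/-- The restriction map is injective when no form of degree `d` lies in the ideal. -/
theorem restrictionMap_injective {d : ℕ}
    (hI : ∀ n f, f.IsHomogeneous n → X 0 * f ∈ I → f ∈ I)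
    (h : ∀ f ∈ I, f.IsHomogeneous d → f = 0) : Function.Injective (restrictionMap I d) := by
  refine (injective_iff_map_eq_zero _).2 fun f hf => ?_
  have h0 := congrFun (congrArg Subtype.val hf) 0
  rw [restrictionMap_apply] at h0
  obtain ⟨n, hn⟩ := algebraMap_away_eq_iff.1 (h0.trans (by simp :
    (0 : coordAway I 0) = algebraMap _ (coordAway I 0) (Ideal.Quotient.mk I 0)))
  rw [sub_zero] at hn
  exact Subtype.ext (h _ (pow_X_mul_mem 0 hI n f.2 hn) f.2)

/-- The restriction map is surjective when any two forms representing a section over the charts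
`0` and `j` come from a form of degree `d`. -/
theorem restrictionMap_surjective {d : ℕ} (j : Fin (N + 1))
    (hI : ∀ n f, f.IsHomogeneous n → X 0 * f ∈ I → f ∈ I)
    (h : ∀ n m f g, f.IsHomogeneous (n + d) → g.IsHomogeneous (m + d) →
      (∃ c, (X 0 * X j) ^ c * (X j ^ m * f - X 0 ^ n * g) ∈ I) →
      ∃ u, u.IsHomogeneous d ∧ f - X 0 ^ n * u ∈ I) :
    Function.Surjective (restrictionMap I d) := by
  intro s
  have hloc (i : Fin (N + 1)) (a : MvPolynomial (Fin (N + 1)) K) :=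
    toOverlapLeft_algebraMap I 0 i (Ideal.Quotient.mk I a)
  have hloc' (i : Fin (N + 1)) (a : MvPolynomial (Fin (N + 1)) K) :=
    toOverlapRight_algebraMap I 0 i (Ideal.Quotient.mk I a)
  obtain ⟨n, f, hf, hs⟩ := s.2.1 0
  have hcompat {i : Fin (N + 1)} {m : ℕ} {g : MvPolynomial (Fin (N + 1)) K}
      (hg : s.1 i * algebraMap _ _ (Ideal.Quotient.mk I (X i)) ^ m =
        algebraMap _ _ (Ideal.Quotient.mk I g)) :
      ∃ c, (X 0 * X i) ^ c * (X i ^ m * f - X 0 ^ n * g) ∈ I := by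
    refine algebraMap_away₂_eq_iff.1 ?_
    have e0 := congrArg (toOverlapLeft I 0 i) hs
    have e1 := congrArg (toOverlapRight I 0 i) hg
    rw [map_mul, map_pow, hloc, hloc] at e0
    rw [map_mul, map_pow, hloc', hloc', ← s.2.2 0 i] at e1
    simp only [map_mul, map_pow, ← e0, ← e1]
    ring
  obtain ⟨m, g, hg, hs'⟩ := s.2.1 j
  obtain ⟨u, hu, hfu⟩ := h n m f g hf hg (hcompat hs')
  refine ⟨⟨u, hu⟩, Subtype.ext (funext fun i => ?_)⟩
  rw [restrictionMap_apply]
  -- On any other chart the equality is checked on the overlap with chart 0; no information is lost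
  -- there because `X 0` can be cancelled modulo `I` on forms.
  obtain ⟨m, g, hg, hs'⟩ := s.2.1 i
  obtain ⟨c, hc⟩ := hcompat hs'
  have hunit : IsUnit (algebraMap _ (coordAway I i) (Ideal.Quotient.mk I (X i)) ^ m) :=
    (IsLocalization.Away.algebraMap_isUnit _).pow m
  refine hunit.mul_right_cancel ?_
  rw [hs', ← map_pow, ← map_pow, ← map_mul, ← map_mul, algebraMap_away_eq_iff]
  refine ⟨c, ?_⟩
  have h1 : X 0 ^ (c + n) * (X i ^ c * (u * X i ^ m - g)) ∈ I := by
    have e : X 0 ^ (c + n) * (X i ^ c * (u * X i ^ m - g)) =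
        (X 0 * X i) ^ c * (X i ^ m * f - X 0 ^ n * g) -
          (X 0 * X i) ^ c * X i ^ m * (f - X 0 ^ n * u) := by
      rw [mul_pow, pow_add]
      ring
    rw [e]
    exact Ideal.sub_mem _ hc (Ideal.mul_mem_left _ _ hfu)
  refine pow_X_mul_mem 0 hI (c + n) (n := c + (m + d)) ?_ h1
  refine (isHomogeneous_X_pow i c).mul (IsHomogeneous.sub ?_ hg)
  rw [add_comm m d]
  exact hu.mul (isHomogeneous_X_pow i m)

end Sections

/-! ### Adding lines to a zero-dimensional scheme. -/

section Union

variable {K : Type*} [Field K] {ι κ : Type*} [Fintype ι] [Fintype κ]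

theorem isHomogeneous_prod_lineForm (v : ι → Fin 3 → K) :
    (∏ i, lineForm (v i)).IsHomogeneous (Fintype.card ι) := by
  simpa using IsHomogeneous.prod Finset.univ (fun i => lineForm (v i)) (fun _ => 1)
    fun i _ => isHomogeneous_lineForm (v i)

/-- If the forms of degree `δ` are in bijection with the values of the linear conditions defining
`J`, the union of the scheme defined by `J` with lines has good postulation. -/
theorem goodPostulation_iInf_lineIdeal_inf {v : ι → Fin 3 → K} (hv : ∀ i, v i 2 ≠ 0)
    (hrel : Pairwise fun i j => IsRelPrime (lineForm (v i)) (lineForm (v j)))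
    {J : Ideal (MvPolynomial (Fin 3) K)} (Φ : MvPolynomial (Fin 3) K →ₗ[K] (κ → K))
    (hΦ : ∀ n f, f.IsHomogeneous n → (f ∈ J ↔ Φ f = 0))
    (hX : ∀ n f, f.IsHomogeneous n → X 0 * f ∈ J → f ∈ J)
    (hF : ∀ n f, f.IsHomogeneous n → (∏ i, lineForm (v i)) * f ∈ J → f ∈ J)
    {δ : ℕ} (hcard : Fintype.card κ = Module.finrank K (homogeneousSubmodule (Fin 3) K δ))
    (hinj : ∀ f, f.IsHomogeneous δ → Φ f = 0 → f = 0) :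
    GoodPostulation ((⨅ i, lineIdeal (v i)) ⊓ J) := by
  set F := ∏ i, lineForm (v i) with hFdef
  set e := Fintype.card ι
  have hFe : F.IsHomogeneous e := isHomogeneous_prod_lineForm v
  have hF0 : F ≠ 0 := Finset.prod_ne_zero_iff.2 fun i _ => lineForm_ne_zero (hv i)
  have hlines (f : MvPolynomial (Fin 3) K) : f ∈ (⨅ i, lineIdeal (v i)) ↔ F ∣ f := by
    simp only [Submodule.mem_iInf, lineIdeal, Ideal.mem_span_singleton]
    exact ⟨fun h => Fintype.prod_dvd_of_isRelPrime hrel h,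
      fun h i => (Finset.dvd_prod_of_mem (fun i => lineForm (v i)) (Finset.mem_univ i)).trans h⟩
  have hXF (i : Fin 3) (hi : i ≠ 2) : IsRelPrime (X i) F :=
    IsRelPrime.prod_right fun l _ => isRelPrime_X_lineForm (hv l) hi
  have hI : ∀ n f, f.IsHomogeneous n → X 0 * f ∈ (⨅ i, lineIdeal (v i)) ⊓ J →
      f ∈ (⨅ i, lineIdeal (v i)) ⊓ J := by
    intro n f hf h
    obtain ⟨h1, h2⟩ := Ideal.mem_inf.1 h
    exact Ideal.mem_inf.2 ⟨(hlines f).2 ((hXF 0 (by decide)).symm.dvd_of_dvd_mul_left ((hlines _).1 h1)),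
      hX n f hf h2⟩
  have hdiv {n : ℕ} {f : MvPolynomial (Fin 3) K} (hf : f.IsHomogeneous (e + n)) (h : F ∣ f) :
      ∃ g, g.IsHomogeneous n ∧ f = F * g := by
    obtain ⟨g, rfl⟩ := h
    refine ⟨_, homogeneousComponent_isHomogeneous n g, ?_⟩
    rw [← homogeneousComponent_mul_of_isHomogeneous hFe, homogeneousComponent_of_mem hf, if_pos rfl]
  -- A power of `X 0` raises the degree to `δ`, where only the zero form satisfies all conditions.
  have hsmall {n : ℕ} (hn : n ≤ δ) {f : MvPolynomial (Fin 3) K} (hf : f.IsHomogeneous n)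
      (h : f ∈ J) : f = 0 := by
    have h1 : (X 0 ^ (δ - n) * f).IsHomogeneous δ := by
      have := (isHomogeneous_X_pow (R := K) (0 : Fin 3) (δ - n)).mul hf
      rwa [Nat.sub_add_cancel hn] at this
    have h2 := hinj _ h1 ((hΦ _ _ h1).1 (Ideal.mul_mem_left _ _ h))
    exact (mul_eq_zero.1 h2).resolve_left (pow_ne_zero _ (X_ne_zero 0))
  -- It suffices to use `u` of the form `X 0 ^ (n - δ)` times a form of degree `δ`: the resulting
  -- map to the conditions is injective because `X 0` cancels modulo `J`, hence bijective by
  -- dimension.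
  have hbig (N n : ℕ) (hn : δ ≤ n) {a : MvPolynomial (Fin 3) K} (ha : a.IsHomogeneous (N + n)) :
      ∃ u, u.IsHomogeneous n ∧ a - X 0 ^ N * u ∈ J := by
    let Ψ : homogeneousSubmodule (Fin 3) K δ →ₗ[K] (κ → K) :=
      Φ ∘ₗ LinearMap.mulLeft K (X 0 ^ (N + (n - δ))) ∘ₗ (homogeneousSubmodule (Fin 3) K δ).subtype
    have hΨ : Function.Injective Ψ := by
      refine (injective_iff_map_eq_zero _).2 fun f hf => ?_
      have h1 : X 0 ^ (N + (n - δ)) * (f : MvPolynomial (Fin 3) K) ∈ J :=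
        (hΦ _ _ ((isHomogeneous_X_pow 0 _).mul f.2)).2 hf
      exact Subtype.ext (hinj _ f.2 ((hΦ _ _ f.2).1 (pow_X_mul_mem 0 hX _ f.2 h1)))
    obtain ⟨u, hu⟩ := (LinearMap.injective_iff_surjective_of_finrank_eq_finrank
      (by rw [← hcard, Module.finrank_fintype_fun_eq_card])).1 hΨ (Φ a)
    have hu' : (X 0 ^ (n - δ) * (u : MvPolynomial (Fin 3) K)).IsHomogeneous n := by
      have := (isHomogeneous_X_pow (R := K) (0 : Fin 3) (n - δ)).mul u.2
      rwa [Nat.sub_add_cancel hn] at this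
    refine ⟨_, hu', (hΦ (N + n) _ (ha.sub ((isHomogeneous_X_pow 0 _).mul hu'))).2 ?_⟩
    rw [map_sub, ← hu, sub_eq_zero, ← mul_assoc, ← pow_add]
    rfl
  intro d hd
  by_cases hde : d ≤ e + δ
  · refine Or.inl (restrictionMap_injective hI ?_)
    intro f h hf
    obtain ⟨h1, h2⟩ := Ideal.mem_inf.1 h
    have h1 := (hlines f).1 h1
    rcases lt_or_ge d e with h | h
    · by_contra hf0
      have h3 := totalDegree_le_of_dvd_of_isDomain h1 hf0
      rw [hf.totalDegree hf0, hFe.totalDegree hF0] at h3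
      omega
    · obtain ⟨n, rfl⟩ := Nat.exists_eq_add_of_le h
      obtain ⟨g, hg, rfl⟩ := hdiv hf h1
      rw [hsmall (by omega) hg (hF _ _ hg h2), mul_zero]
  · refine Or.inr (restrictionMap_surjective 1 hI ?_)
    obtain ⟨r, rfl⟩ := Nat.exists_eq_add_of_le (show e ≤ d by omega)
    rintro n m f g hf hg ⟨c, hc⟩
    have hc := (Ideal.mem_inf.1 hc).1
    have h1 : F ∣ X 1 ^ m * f - X 0 ^ n * g := by
      refine IsRelPrime.dvd_of_dvd_mul_left (IsRelPrime.pow_right ?_) ((hlines _).1 hc)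
      exact (hXF 0 (by decide)).symm.mul_right (hXF 1 (by decide)).symm
    obtain ⟨h, hh⟩ := h1
    -- The lines avoid `X 0 = X 1 = 0`, so `F` is a nonzerodivisor modulo `(X 0 ^ n, X 1 ^ m)`. This
    -- splits the discrepancy between the two charts and shows that the section on the lines lifts
    -- to a form.
    have h2 : h ∈ Ideal.span {(X 0 ^ n : MvPolynomial (Fin 3) K), X 1 ^ m} := by
      refine mem_of_prod_lineForm_mul_mem Finset.univ hv n m ?_
      rw [← hFdef, ← hh]
      exact Ideal.sub_mem _ (Ideal.mul_mem_right _ _ (Ideal.subset_span (by simp)))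
        (Ideal.mul_mem_right _ _ (Ideal.subset_span (by simp)))
    obtain ⟨b, a, hab⟩ := Ideal.mem_span_pair.1 h2
    have h3 : X 0 ^ n ∣ f - F * a := by
      have hrp : IsRelPrime (X 0 ^ n : MvPolynomial (Fin 3) K) (X 1 ^ m) :=
        IsRelPrime.pow ((X_prime.irreducible.isRelPrime_iff_not_dvd).2 fun h => by
          simpa using X_dvd_X.1 h)
      refine hrp.dvd_of_dvd_mul_left ⟨g + F * b, ?_⟩
      rw [← hab] at hh
      linear_combination hh
    obtain ⟨w, hw⟩ := h3
    -- The quotients found so far need not be homogeneous; their components of the right degree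
    -- satisfy the same identity.
    set w' := homogeneousComponent (e + r) w
    set a' := homogeneousComponent (n + r) a
    have hf' : f = F * a' + X 0 ^ n * w' := by
      have := congrArg (homogeneousComponent (n + (e + r))) (sub_eq_iff_eq_add.1 hw)
      rw [homogeneousComponent_of_mem hf, if_pos rfl, map_add,
        homogeneousComponent_mul_of_isHomogeneous (isHomogeneous_X_pow 0 n),
        show n + (e + r) = e + (n + r) by ring,
        homogeneousComponent_mul_of_isHomogeneous hFe] at this
      exact this.trans (add_comm _ _)
    obtain ⟨u, hu, hau⟩ := hbig n r (by omega) (homogeneousComponent_isHomogeneous (n + r) a)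
    -- `w'` has the prescribed values on the lines, and `F * u` corrects it along `J` without
    -- changing those values.
    refine ⟨w' + F * u, (homogeneousComponent_isHomogeneous _ _).add (hFe.mul hu), ?_⟩
    have : f - X 0 ^ n * (w' + F * u) = F * (a' - X 0 ^ n * u) := by
      rw [hf']
      ring
    rw [this]
    exact Ideal.mem_inf.2 ⟨(hlines _).2 (dvd_mul_right _ _), Ideal.mul_mem_left _ _ hau⟩

end Union

/-! ### General properties and openness of independence. -/

section Generic

variable {K ι : Type*} [Field K]

theorem HoldsGenerically.mono {P Q : (ι → K) → Prop} (h : HoldsGenerically P)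
    (hPQ : ∀ v, P v → Q v) : HoldsGenerically Q := by
  obtain ⟨G, hG, h⟩ := h
  exact ⟨G, hG, fun v hv => hPQ v (h v hv)⟩

theorem HoldsGenerically.and {P Q : (ι → K) → Prop} (hP : HoldsGenerically P)
    (hQ : HoldsGenerically Q) : HoldsGenerically fun v => P v ∧ Q v := by
  obtain ⟨G, hG, h⟩ := hP
  obtain ⟨G', hG', h'⟩ := hQ
  refine ⟨G * G', mul_ne_zero hG hG', fun v hv => ?_⟩
  rw [map_mul] at hv
  exact ⟨h v (left_ne_zero_of_mul hv), h' v (right_ne_zero_of_mul hv)⟩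

theorem HoldsGenerically.forall {α : Type*} [Finite α] {P : α → (ι → K) → Prop}
    (h : ∀ a, HoldsGenerically (P a)) : HoldsGenerically fun v => ∀ a, P a v := by
  cases nonempty_fintype α
  choose G hG h using h
  refine ⟨∏ a, G a, Finset.prod_ne_zero_iff.2 fun a _ => hG a, fun v hv a => h a v ?_⟩
  rw [map_prod] at hv
  exact Finset.prod_ne_zero_iff.1 hv a (Finset.mem_univ a)

theorem holdsGenerically_aeval_ne_zero (G : MvPolynomial ι K) (v : ι → K) (hv : aeval v G ≠ 0) :
    HoldsGenerically fun v : ι → K => aeval v G ≠ 0 :=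
  ⟨G, by rintro rfl; simp at hv, fun _ h => h⟩

/-- Linear conditions depending polynomially on parameters, if independent for one value of the
parameters, are independent for general values. -/
theorem holdsGenerically_surjective {A κ : Type*} [AddCommGroup A] [Module K A] [Fintype κ]
    (S : Submodule K A) (Φ : κ → A → MvPolynomial ι K) (Ψ : (ι → K) → A →ₗ[K] (κ → K))
    (hΨ : ∀ v i f, Ψ v f i = aeval v (Φ i f)) (v₀ : ι → K)
    (h : ∀ y, ∃ f ∈ S, Ψ v₀ f = y) :
    HoldsGenerically fun v => ∀ y, ∃ f ∈ S, Ψ v f = y := by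
  classical
  -- Vectors dual to the conditions at `v₀` are kept fixed while `v` varies; their matrix of
  -- conditions is the identity at `v₀`, so its determinant is a nonzero polynomial in `v`.
  choose f hfS hf using fun j => h (Pi.single j 1)
  have hdet (v : ι → K) : aeval v (Matrix.of fun i j => Φ i (f j)).det =
      (Matrix.of fun i j => Ψ v (f j) i).det := by
    rw [AlgHom.map_det]
    congr 1
    ext i j
    simp [hΨ]
  refine (holdsGenerically_aeval_ne_zero (Matrix.of fun i j => Φ i (f j)).det v₀ ?_).mono
    fun v hv y => ?_
  · rw [hdet, show (Matrix.of fun i j => Ψ v₀ (f j) i) = 1 by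
      ext i j
      simp [hf, Matrix.one_apply, Pi.single_apply], Matrix.det_one]
    exact one_ne_zero
  · rw [hdet] at hv
    obtain ⟨c, hc⟩ := (Matrix.mulVec_surjective_iff_isUnit.2
      ((Matrix.isUnit_iff_isUnit_det _).2 (isUnit_iff_ne_zero.2 hv))) y
    refine ⟨∑ j, c j • f j, Submodule.sum_mem _ fun j _ => S.smul_mem _ (hfS j), ?_⟩
    rw [← hc]
    ext i
    simp [Matrix.mulVec, dotProduct, mul_comm]

end Generic

/-! ### Trace schemes as lines together with linear conditions. -/

namespace TraceType

variable (t : TraceType) (M : Finset (Fin t.starLines × Fin t.starLines))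

/-- Indices of the zero-dimensional components, other than the general points. -/
abbrev Core : Type :=
  Fin t.doubles ⊕ Fin t.lengthTwos ⊕ {x : Fin t.starLines × Fin t.starLines // x.1 < x.2 ∧ x ∉ M} ⊕
    Fin t.collinear

/-- Indices of the zero-dimensional components. -/
abbrev Component : Type := t.Core M ⊕ Fin t.points

variable {t M}

/-- The support of a zero-dimensional component. -/
def center {R : Type*} [CommRing R] (v : t.Coord → R) : t.Component M → Fin 3 → R
  | .inl (.inl i) => fun c => v (.double i c)
  | .inl (.inr (.inl i)) => fun c => v (.support i c)
  | .inl (.inr (.inr (.inl x))) =>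
      crossProduct (fun c => v (.star x.1.1 c)) (fun c => v (.star x.1.2 c))
  | .inl (.inr (.inr (.inr i))) => fun c =>
      v (.collinear i 0) * v (.base 0 c) + v (.collinear i 1) * v (.base 1 c)
  | .inr i => fun c => v (.point i c)

/-- The dimension of the tangent space of a zero-dimensional component. -/
def tangentDim : t.Component M → ℕ
  | .inl (.inl _) => 2
  | .inl (.inr (.inl _)) => 1
  | .inl (.inr (.inr _)) => 0
  | .inr _ => 0

/-- Directions spanning the tangent space of a zero-dimensional component. -/
def tangent {R : Type*} [CommRing R] (v : t.Coord → R) :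
    (x : t.Component M) → Fin (tangentDim x) → Fin 3 → R
  | .inl (.inl _) => fun d : Fin 2 => Pi.single d.succ 1
  | .inl (.inr (.inl i)) => fun _ c => v (.direction i c)
  | .inl (.inr (.inr _)) => fun d : Fin 0 => d.elim0
  | .inr _ => fun d : Fin 0 => d.elim0

/-- The ideal of a zero-dimensional component. -/
noncomputable def componentIdeal {K : Type*} [Field K] (v : t.Coord → K) :
    t.Component M → Ideal (MvPolynomial (Fin 3) K)
  | .inl (.inl i) => doublePointIdeal fun c => v (.double i c)
  | .inl (.inr (.inl i)) =>
      lengthTwoIdeal (fun c => v (.support i c)) (fun c => v (.direction i c))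
  | .inl (.inr (.inr (.inl x))) => pointIdeal
      (crossProduct (fun c => v (.star x.1.1 c)) (fun c => v (.star x.1.2 c)))
  | .inl (.inr (.inr (.inr i))) => pointIdeal fun c =>
      v (.collinear i 0) * v (.base 0 c) + v (.collinear i 1) * v (.base 1 c)
  | .inr i => pointIdeal fun c => v (.point i c)

theorem ideal_eq {K : Type*} [Field K] (v : t.Coord → K) :
    t.ideal M v =
      (⨅ i, lineIdeal fun c => v (.line i c)) ⊓ ⨅ x : t.Component M, componentIdeal v x := by
  ext f
  simp only [ideal, Ideal.mem_inf, Submodule.mem_iInf, Sum.forall, Subtype.forall, Prod.forall]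
  constructor
  · rintro ⟨⟨⟨⟨⟨h1, h2⟩, h3⟩, h4⟩, h5⟩, h6⟩
    exact ⟨h1, ⟨h2, h3, h4, h6⟩, h5⟩
  · rintro ⟨h1, ⟨h2, h3, h4, h6⟩, h5⟩
    exact ⟨⟨⟨⟨⟨h1, h2⟩, h3⟩, h4⟩, h5⟩, h6⟩

/-- Indices of the linear conditions imposed by the zero-dimensional components. -/
abbrev Condition (t : TraceType) (M : Finset (Fin t.starLines × Fin t.starLines)) : Type :=
  Σ x : t.Component M, Option (Fin (tangentDim x))

/-- The linear conditions imposed by the zero-dimensional components. -/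
noncomputable def condition (K : Type*) [Field K] {R : Type*} [CommRing R] [Algebra K R]
    (v : t.Coord → R) (i : Condition t M) : MvPolynomial (Fin 3) K →ₗ[K] R :=
  jet K (center v i.1) (i.2.map (tangent v i.1))

section Naturality

variable {K : Type*} [Field K] {R S : Type*} [CommRing R] [Algebra K R] [CommRing S] [Algebra K S]

theorem map_center (φ : R →ₐ[K] S) (v : t.Coord → R) (x : t.Component M) :
    (fun c => φ (center v x c)) = center (fun i => φ (v i)) x := by
  rcases x with (i | i | x | i) | i
  · rfl
  · rfl
  · ext c
    fin_cases c <;> simp [center, cross_apply]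
  · ext c
    simp [center]
  · rfl

theorem map_tangent (φ : R →ₐ[K] S) (v : t.Coord → R) (x : t.Component M)
    (d : Fin (tangentDim x)) :
    (fun c => φ (tangent v x d c)) = tangent (fun i => φ (v i)) x d := by
  rcases x with (i | i | x | i) | i
  · ext c
    simp [tangent, Pi.single_apply, apply_ite φ]
  · rfl
  · exact d.elim0
  · exact d.elim0
  · exact d.elim0

/-- Taking the coordinates to be indeterminates gives universal conditions, which specialise to
those at any `v`. This makes the conditions polynomial in `v`. -/
theorem map_condition (φ : R →ₐ[K] S) (v : t.Coord → R) (i : Condition t M)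
    (f : MvPolynomial (Fin 3) K) :
    φ (condition K v i f) = condition K (fun i => φ (v i)) i f := by
  obtain ⟨x, o⟩ := i
  rw [condition, condition, jet_map, map_center]
  cases o with
  | none => rfl
  | some d => simp only [Option.map_some, map_tangent]

end Naturality

variable {K : Type*} [Field K]

/-- Nondegeneracy conditions on the coordinates of a trace scheme. -/
structure IsRegular (M : Finset (Fin t.starLines × Fin t.starLines)) (v : t.Coord → K) : Prop where
  -- The lines avoid (0:0:1) and are pairwise distinct; the supports avoid `X 0 = 0` and the lines;
  -- the last field ensures that the direction points determine tangent lines.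
  line : ∀ i, v (.line i 2) ≠ 0
  line_cross : ∀ i j, i ≠ j →
    crossProduct (fun c => v (.line i c)) (fun c => v (.line j c)) 0 ≠ 0
  center : ∀ x : t.Component M, center v x 0 ≠ 0
  center_line : ∀ (x : t.Component M) i, ∑ c, v (.line i c) * TraceType.center v x c ≠ 0
  direction : ∀ i, crossProduct (fun c => v (.support i c)) (fun c => v (.direction i c)) 2 ≠ 0

theorem mem_componentIdeal_iff {v : t.Coord → K} (hv : IsRegular M v) (x : t.Component M) {n : ℕ}
    {f : MvPolynomial (Fin 3) K} (hf : f.IsHomogeneous n) :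
    f ∈ componentIdeal v x ↔ ∀ o, condition K v ⟨x, o⟩ f = 0 := by
  have h0 := hv.center x
  rw [Option.forall]
  rcases x with (i | i | x | i) | i
  · exact mem_doublePointIdeal_iff h0 hf
  · refine (mem_lengthTwoIdeal_iff h0 (hv.direction i) hf).trans (and_congr Iff.rfl ?_)
    exact (Fin.forall_fin_one (p := fun d : Fin 1 =>
      condition K v ⟨Sum.inl (Sum.inr (Sum.inl i)), some d⟩ f = 0)).symm
  all_goals exact (mem_pointIdeal_iff h0 hf).trans (iff_self_and.2 fun _ d => d.elim0)

/-- By the Leibniz rule a factor not vanishing at the support can be cancelled. This serves both for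
`X 0` and for the product of the lines. -/
theorem mem_componentIdeal_of_mul_mem {v : t.Coord → K} (hv : IsRegular M v) (x : t.Component M)
    {m n : ℕ} {g f : MvPolynomial (Fin 3) K} (hg : g.IsHomogeneous m) (hf : f.IsHomogeneous n)
    (h0 : aeval (center v x) g ≠ 0) (h : g * f ∈ componentIdeal v x) :
    f ∈ componentIdeal v x := by
  rw [mem_componentIdeal_iff hv x (hg.mul hf), Option.forall] at h
  rw [mem_componentIdeal_iff hv x hf, Option.forall]
  have h1 : aeval (center v x) f = 0 := by
    have : aeval (center v x) (g * f) = 0 := h.1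
    rw [map_mul] at this
    exact (mul_eq_zero.1 this).resolve_left h0
  refine ⟨h1, fun d => ?_⟩
  have h2 : jet K (center v x) (some (tangent v x d)) (g * f) = 0 := h.2 d
  rw [jet_some_mul, h1, mul_zero, zero_add] at h2
  exact (mul_eq_zero.1 h2).resolve_left h0

theorem IsRegular.goodPostulation {v : t.Coord → K} (hv : IsRegular M v) {δ : ℕ}
    (hcard : Fintype.card (Condition t M) =
      Module.finrank K (homogeneousSubmodule (Fin 3) K δ))
    (hsurj : ∀ y : Condition t M → K, ∃ f ∈ homogeneousSubmodule (Fin 3) K δ,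
      LinearMap.pi (condition K v) f = y) :
    GoodPostulation (t.ideal M v) := by
  rw [ideal_eq]
  refine goodPostulation_iInf_lineIdeal_inf hv.line ?_
    (LinearMap.pi (condition K v)) ?_ ?_ ?_ hcard ?_
  · intro i j hij
    refine isRelPrime_lineForm (hv.line i) (hv.line j) fun c hc => hv.line_cross i j hij ?_
    have h1 := congrFun hc 1
    have h2 := congrFun hc 2
    simp only [Pi.smul_apply, smul_eq_mul] at h1 h2
    simp only [cross_apply, Matrix.cons_val, h1, h2]
    ring
  · intro n f hf
    simp only [Submodule.mem_iInf, mem_componentIdeal_iff hv _ hf, funext_iff, Sigma.forall]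
    rfl
  · intro n f hf h
    simp only [Submodule.mem_iInf] at h ⊢
    exact fun x => mem_componentIdeal_of_mul_mem hv x (isHomogeneous_X K 0) hf
      (by rw [aeval_X]; exact hv.center x) (h x)
  · intro n f hf h
    simp only [Submodule.mem_iInf] at h ⊢
    refine fun x => mem_componentIdeal_of_mul_mem hv x (isHomogeneous_prod_lineForm _) hf ?_ (h x)
    rw [map_prod]
    refine Finset.prod_ne_zero_iff.2 fun i _ => ?_
    rw [aeval_lineForm]
    exact hv.center_line x i
  · intro f hf h
    let Ψ : homogeneousSubmodule (Fin 3) K δ →ₗ[K] (Condition t M → K) :=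
      LinearMap.pi (condition K v) ∘ₗ (homogeneousSubmodule (Fin 3) K δ).subtype
    have hΨ : Function.Injective Ψ :=
      (LinearMap.injective_iff_surjective_of_finrank_eq_finrank
        (by rw [← hcard, Module.finrank_fintype_fun_eq_card])).2 fun y => by
          obtain ⟨g, hg, rfl⟩ := hsurj y
          exact ⟨⟨g, hg⟩, rfl⟩
    exact congrArg Subtype.val (hΨ (a₁ := ⟨f, hf⟩) (a₂ := 0) (h.trans (map_zero Ψ).symm))

/-- General trace schemes are nondegenerate. -/
theorem holdsGenerically_isRegular [Infinite K]
    (M : Finset (Fin t.starLines × Fin t.starLines)) :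
    HoldsGenerically fun v : t.Coord → K => IsRegular M v := by
  let s : ℕ ↪ K := Infinite.natEmbedding K
  -- All supports collapse to (1:0:0), through which every star line passes while the lines `(1, s
  -- i, 1)` miss it. Such coincidences are harmless, since the nondegeneracy conditions do not
  -- separate the supports.
  let v₀ : t.Coord → K
    | .line i c => ![1, s i, 1] c
    | .double _ c => ![1, 0, 0] c
    | .support _ c => ![1, 0, 0] c
    | .direction _ c => ![0, 1, 0] c
    | .star i c => ![0, s i, 1] c
    | .point _ c => ![1, 0, 0] c
    | .base _ c => ![1, 0, 0] c
    | .collinear _ e => ![1, 0] e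
  have hs {i j : ℕ} (h : i ≠ j) : s i - s j ≠ 0 := sub_ne_zero.2 (s.injective.ne h)
  have hc (x : t.Component M) : TraceType.center v₀ x 0 ≠ 0 ∧ TraceType.center v₀ x 1 = 0 ∧
      TraceType.center v₀ x 2 = 0 := by
    rcases x with (i | i | ⟨x, hx, _⟩ | i) | i <;>
      simp [TraceType.center, v₀, cross_apply]
    exact hs (Fin.val_ne_of_ne hx.ne)
  have hX (x : t.Component M) (v : t.Coord → K) (c : Fin 3) :
      aeval v (TraceType.center (X : t.Coord → MvPolynomial _ K) x c) =
        TraceType.center v x c := by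
    have := congrFun (map_center (aeval v : MvPolynomial t.Coord K →ₐ[K] K) X x) c
    simpa only [aeval_X] using this
  have h1 : HoldsGenerically fun v : t.Coord → K => ∀ i, v (.line i 2) ≠ 0 := by
    refine .forall fun i => ?_
    simpa using holdsGenerically_aeval_ne_zero (K := K) (X (.line i 2)) v₀ (by simp [v₀])
  have h2 : HoldsGenerically fun v : t.Coord → K => ∀ i j, i ≠ j →
      crossProduct (fun c => v (.line i c)) (fun c => v (.line j c)) 0 ≠ 0 := by
    refine .forall fun i => .forall fun j => ?_
    by_cases hij : i = j
    · exact ⟨1, one_ne_zero, fun _ _ h => absurd hij h⟩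
    · refine (holdsGenerically_aeval_ne_zero (K := K) (X (.line i 1) * X (.line j 2) -
        X (.line i 2) * X (.line j 1)) v₀ ?_).mono fun v hv _ => ?_
      · simpa [v₀] using hs (Fin.val_ne_of_ne hij)
      · simpa [cross_apply] using hv
  have h3 : HoldsGenerically fun v : t.Coord → K => ∀ x : t.Component M,
      TraceType.center v x 0 ≠ 0 := by
    refine .forall fun x => ?_
    simpa only [hX] using holdsGenerically_aeval_ne_zero (K := K)
      (TraceType.center (X : t.Coord → MvPolynomial _ K) x 0) v₀ (by rw [hX]; exact (hc x).1)
  have h4 : HoldsGenerically fun v : t.Coord → K => ∀ (x : t.Component M) i,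
      ∑ c, v (.line i c) * TraceType.center v x c ≠ 0 := by
    refine .forall fun x => .forall fun i => ?_
    refine (holdsGenerically_aeval_ne_zero (K := K) (∑ c, X (.line i c) *
      TraceType.center (X : t.Coord → MvPolynomial _ K) x c) v₀ ?_).mono fun v hv => ?_
    · simp only [map_add, map_mul, hX, aeval_X, Fin.sum_univ_three, (hc x).2.1, (hc x).2.2,
        mul_zero, add_zero]
      exact mul_ne_zero one_ne_zero (hc x).1
    · simpa only [map_sum, map_mul, hX, aeval_X] using hv
  have h5 : HoldsGenerically fun v : t.Coord → K => ∀ i,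
      crossProduct (fun c => v (.support i c)) (fun c => v (.direction i c)) 2 ≠ 0 := by
    refine .forall fun i => ?_
    refine (holdsGenerically_aeval_ne_zero (K := K) (X (.support i 0) * X (.direction i 1) -
      X (.support i 1) * X (.direction i 0)) v₀ ?_).mono fun v hv => ?_
    · simp [v₀]
    · simpa [cross_apply] using hv
  exact (h1.and (h2.and (h3.and (h4.and h5)))).mono fun v h => ⟨h.1, h.2.1, h.2.2.1, h.2.2.2.1,
    h.2.2.2.2⟩

/-- If the zero-dimensional components impose independent conditions on forms of degree `δ` for one
choice of coordinates, and there are as many conditions as forms, then the trace scheme has good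
postulation for general coordinates. -/
theorem holdsGenerically_goodPostulation [Infinite K] {δ : ℕ}
    (hcard : Fintype.card (Condition t M) =
      Module.finrank K (homogeneousSubmodule (Fin 3) K δ)) (v₀ : t.Coord → K)
    (hsurj : ∀ y : Condition t M → K, ∃ f ∈ homogeneousSubmodule (Fin 3) K δ,
      LinearMap.pi (condition K v₀) f = y) :
    HoldsGenerically fun v : t.Coord → K => GoodPostulation (t.ideal M v) := by
  -- Nondegeneracy and independence are both open, so they may be witnessed at different positions;
  -- `v₀` itself need not be nondegenerate.
  refine ((holdsGenerically_isRegular M).and (holdsGenerically_surjective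
    (homogeneousSubmodule (Fin 3) K δ)
    (fun i f => condition K (X : t.Coord → MvPolynomial _ K) i f)
    (fun v => LinearMap.pi (condition K v)) (fun v i f => ?_) v₀ hsurj)).mono
      fun v h => h.1.goodPostulation hcard h.2
  rw [map_condition]
  simp

end TraceType

/-! ### Triangular systems and general points. -/

section LinearAlgebra

variable {K : Type*} [Field K]

/-- Linear conditions admitting a triangular system of dual vectors are independent. -/
theorem exists_eq_of_triangular {A κ : Type*} [AddCommGroup A] [Module K A] [Fintype κ]
    (S : Submodule K A) (Φ : A →ₗ[K] (κ → K)) (r : κ → ℕ)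
    (h : ∀ i, ∃ f ∈ S, Φ f i ≠ 0 ∧ ∀ j, j ≠ i → r i ≤ r j → Φ f j = 0) (y : κ → K) :
    ∃ f ∈ S, Φ f = y := by
  classical
  suffices S.map Φ = ⊤ by
    obtain ⟨f, hf, hy⟩ := (this ▸ Submodule.mem_top : y ∈ S.map Φ)
    exact ⟨f, hf, hy⟩
  by_contra hne
  -- A functional vanishing on the image is shown to kill every basis vector, by induction on the
  -- rank: the dual vector of `i` involves, besides `i`, only conditions of smaller rank.
  obtain ⟨ψ, hψ, hle⟩ := Submodule.exists_le_ker_of_lt_top _ (lt_top_iff_ne_top.2 hne)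
  have hsum (z : κ → K) : ψ z = ∑ i, z i * ψ (Pi.single i 1) := by
    conv_lhs => rw [pi_eq_sum_univ' z, map_sum]
    simp
  have key (n : ℕ) : ∀ i, r i = n → ψ (Pi.single i 1) = 0 := by
    induction n using Nat.strong_induction_on with
    | _ n ih =>
      intro i hi
      obtain ⟨f, hf, hfi, hfj⟩ := h i
      have h0 : ψ (Φ f) = 0 := hle ⟨f, hf, rfl⟩
      rw [hsum, Finset.sum_eq_single i (fun j _ hji => ?_) (by simp)] at h0
      · exact (mul_eq_zero.1 h0).resolve_left hfi
      · rcases lt_or_ge (r j) n with hj | hj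
        · rw [ih _ hj j rfl, mul_zero]
        · rw [hfj j hji (hi ▸ hj), zero_mul]
  refine hψ (LinearMap.ext fun z => ?_)
  rw [hsum, LinearMap.zero_apply]
  exact Finset.sum_eq_zero fun i _ => by rw [key _ i rfl, mul_zero]

/-- General points impose independent additional conditions. -/
theorem exists_points [Infinite K] {σ κ : Type*} [Fintype κ] (S : Submodule K (MvPolynomial σ K))
    [FiniteDimensional K S] (Φ : MvPolynomial σ K →ₗ[K] (κ → K)) (h : ∀ y, ∃ f ∈ S, Φ f = y)
    (p : ℕ) (hp : Fintype.card κ + p ≤ Module.finrank K S) :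
    ∃ P : Fin p → σ → K, ∀ (y : κ → K) (z : Fin p → K), ∃ f ∈ S, Φ f = y ∧ ∀ i, aeval (P i) f = z i := by
  induction p with
  | zero =>
    refine ⟨Fin.elim0, fun y z => ?_⟩
    obtain ⟨f, hf, hy⟩ := h y
    exact ⟨f, hf, hy, fun i => i.elim0⟩
  | succ p ih =>
    obtain ⟨P, hP⟩ := ih (by omega)
    let Ψ : S →ₗ[K] (κ → K) × (Fin p → K) :=
      (Φ.prod (LinearMap.pi fun i => (aeval (P i)).toLinearMap)) ∘ₗ S.subtype
    -- There are still fewer conditions than the dimension of `S`, so some nonzero `f₀` satisfies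
    -- them all; over an infinite field it is nonzero at some `Q`, which becomes the next point.
    obtain ⟨f₀, hf₀, hne⟩ := Submodule.exists_mem_ne_zero_of_ne_bot
      (LinearMap.ker_ne_bot_of_finrank_lt (f := Ψ) (by
        rw [Module.finrank_prod, Module.finrank_fintype_fun_eq_card,
          Module.finrank_fintype_fun_eq_card, Fintype.card_fin]
        omega))
    obtain ⟨Q, hQ⟩ : ∃ Q : σ → K, aeval Q (f₀ : MvPolynomial σ K) ≠ 0 := by
      by_contra! hall
      refine hne (Subtype.ext (MvPolynomial.funext fun Q => ?_))
      simpa using hall Q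
    have h1 : Φ f₀ = 0 := congrArg Prod.fst hf₀
    have h2 (i : Fin p) : aeval (P i) (f₀ : MvPolynomial σ K) = 0 :=
      congrFun (congrArg Prod.snd hf₀) i
    refine ⟨Fin.snoc P Q, fun y z => ?_⟩
    obtain ⟨f, hf, hy, hz⟩ := hP y fun i => z i.castSucc
    refine ⟨f + ((z (Fin.last p) - aeval Q f) / aeval Q (f₀ : MvPolynomial σ K)) •
      (f₀ : MvPolynomial σ K), S.add_mem hf (S.smul_mem _ f₀.2), ?_, fun i => ?_⟩
    · rw [map_add, map_smul, h1, smul_zero, add_zero, hy]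
    · refine Fin.lastCases ?_ (fun i => ?_) i
      · rw [Fin.snoc_last, map_add, map_smul, smul_eq_mul, div_mul_cancel₀ _ hQ]
        ring
      · rw [Fin.snoc_castSucc, map_add, map_smul, h2, smul_zero, add_zero, hz]

end LinearAlgebra

/-! ### Arrangements of lines dual to a conic and their dual forms. -/

section Conic

variable {K : Type*} [Field K]

/-- The line dual to the point with parameter `s` of a conic. -/
def conicLine (s : K) : Fin 3 → K := ![s ^ 2, s, 1]

/-- The intersection point of the lines with parameters `s` and `u`. -/
def conicPoint (s u : K) : Fin 3 → K := ![1, -(s + u), s * u]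

/-- This factorisation controls all incidences: lines with distinct parameters are never concurrent
in threes, in any characteristic. -/
theorem aeval_conicPoint (s u w : K) :
    aeval (conicPoint s u) (lineForm (conicLine w)) = (w - s) * (w - u) := by
  simp only [aeval_lineForm, conicLine, conicPoint, Fin.sum_univ_three, Matrix.cons_val,
    Algebra.algebraMap_self, RingHom.id_apply]
  ring

theorem crossProduct_conicLine (s u : K) :
    crossProduct (conicLine s) (conicLine u) = (s - u) • conicPoint s u := by
  ext c
  fin_cases c <;> simp [cross_apply, conicLine, conicPoint] <;> ring

theorem aeval_crossProduct_conicLine (s u w : K) :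
    aeval (crossProduct (conicLine s) (conicLine u)) (lineForm (conicLine w)) =
      (s - u) * ((w - s) * (w - u)) := by
  rw [crossProduct_conicLine, ← aeval_conicPoint]
  simp [aeval_lineForm, Finset.mul_sum, mul_left_comm]

variable {α : Type*} [Fintype α] [DecidableEq α] (s : α → K)

/-- The product of the lines not containing the intersection point of the lines `a` and `b`. -/
noncomputable def nodeForm (a b : α) : MvPolynomial (Fin 3) K :=
  ∏ l ∈ (Finset.univ.erase a).erase b, lineForm (conicLine (s l))

theorem isHomogeneous_nodeForm {a b : α} (hab : a ≠ b) :
    (nodeForm s a b).IsHomogeneous (Fintype.card α - 2) := by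
  have := IsHomogeneous.prod ((Finset.univ.erase a).erase b)
    (fun l => lineForm (conicLine (s l))) (fun _ => 1) fun i _ => isHomogeneous_lineForm _
  rw [Finset.sum_const, smul_eq_mul, mul_one, Finset.card_erase_of_mem (by simp [hab.symm]),
    Finset.card_erase_of_mem (by simp), Finset.card_univ, Nat.sub_sub] at this
  exact this

variable {s}

theorem aeval_nodeForm_ne_zero (hs : Function.Injective s) (a b : α) :
    aeval (conicPoint (s a) (s b)) (nodeForm s a b) ≠ 0 := by
  rw [nodeForm, map_prod, Finset.prod_ne_zero_iff]
  intro l hl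
  simp only [Finset.mem_erase] at hl
  rw [aeval_conicPoint]
  exact mul_ne_zero (sub_ne_zero.2 (hs.ne hl.2.1)) (sub_ne_zero.2 (hs.ne hl.1))

theorem aeval_nodeForm_eq_zero {a b c d : α} (h : (c ≠ a ∧ c ≠ b) ∨ (d ≠ a ∧ d ≠ b)) :
    aeval (conicPoint (s c) (s d)) (nodeForm s a b) = 0 := by
  rw [nodeForm, map_prod, Finset.prod_eq_zero_iff]
  rcases h with h | h
  · exact ⟨c, by simp [h], by rw [aeval_conicPoint]; ring⟩
  · exact ⟨d, by simp [h], by rw [aeval_conicPoint]; ring⟩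

/-- A form dual to the value at the node `(a, b)`. -/
theorem exists_form_dual_value (hs : Function.Injective s) {a b : α} (hab : a ≠ b) {δ : ℕ}
    (hδ : 2 * (Fintype.card α - 2) ≤ δ) :
    ∃ f : MvPolynomial (Fin 3) K, f.IsHomogeneous δ ∧ aeval (conicPoint (s a) (s b)) f ≠ 0 ∧
      ∀ c d, ((c ≠ a ∧ c ≠ b) ∨ (d ≠ a ∧ d ≠ b)) → ∀ o,
        jet K (conicPoint (s c) (s d)) o f = 0 := by
  -- The square makes the form singular at the other nodes; the power of `X 0`, which is 1 at every
  -- node, only adjusts the degree.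
  refine ⟨nodeForm s a b * (nodeForm s a b * X 0 ^ (δ - 2 * (Fintype.card α - 2))), ?_, ?_, ?_⟩
  · have h := isHomogeneous_nodeForm s hab
    convert h.mul (h.mul (isHomogeneous_X_pow (0 : Fin 3) (δ - 2 * (Fintype.card α - 2)))) using 1
    omega
  · have h := aeval_nodeForm_ne_zero hs a b
    have h0 : aeval (conicPoint (s a) (s b)) (X 0 : MvPolynomial (Fin 3) K) ≠ 0 := by
      simp [conicPoint]
    simp only [map_mul, map_pow]
    exact mul_ne_zero h (mul_ne_zero h (pow_ne_zero _ h0))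
  · intro c d h o
    have h0 := aeval_nodeForm_eq_zero (s := s) h
    exact jet_mul_eq_zero_of_aeval o h0 (by rw [map_mul, h0, zero_mul])

/-- A form dual to a derivative at the node `(a, b)`. -/
theorem exists_form_dual_derivative (hs : Function.Injective s) {a b : α} (hab : a ≠ b) {δ : ℕ}
    (hδ : 2 * (Fintype.card α - 2) + 1 ≤ δ) (j : Fin 2) :
    ∃ f : MvPolynomial (Fin 3) K, f.IsHomogeneous δ ∧ aeval (conicPoint (s a) (s b)) f = 0 ∧
      (∀ i : Fin 2, jet K (conicPoint (s a) (s b)) (some (Pi.single i.succ 1)) f ≠ 0 ↔ i = j) ∧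
      ∀ c d, ((c ≠ a ∧ c ≠ b) ∨ (d ≠ a ∧ d ≠ b)) → ∀ o,
        jet K (conicPoint (s c) (s d)) o f = 0 := by
  set P := conicPoint (s a) (s b) with hP
  -- The linear form `X (j + 1) - P (j + 1) * X 0` vanishes at `P`, as `P 0 = 1`, and among the two
  -- tangent directions it only sees the `j`-th.
  set w : Fin 3 → K := Pi.single j.succ 1 - Pi.single 0 (P j.succ) with hw
  set r := δ - 2 * (Fintype.card α - 2) - 1 with hr
  have hw0 : aeval P (lineForm w) = 0 := by
    simp [aeval_lineForm, hw, sub_mul, Finset.sum_sub_distrib, Pi.single_apply]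
    simp [hP, conicPoint]
  have h := aeval_nodeForm_ne_zero hs a b
  refine ⟨nodeForm s a b * (nodeForm s a b * (X 0 ^ r * lineForm w)), ?_, ?_, ?_, ?_⟩
  · have h := isHomogeneous_nodeForm s hab
    convert h.mul (h.mul ((isHomogeneous_X_pow (0 : Fin 3) r).mul (isHomogeneous_lineForm w)))
      using 1
    omega
  · simp only [map_mul, hw0, mul_zero]
  · intro i
    have h0 : aeval P (X 0 : MvPolynomial (Fin 3) K) ≠ 0 := by
      simp [hP, conicPoint]
    have e : jet K P (some (Pi.single i.succ 1)) (lineForm w) = if i = j then 1 else 0 := by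
      simp [jet_some, pderiv_lineForm, hw, Pi.single_apply]
    simp only [jet_some_mul, map_mul, hw0, mul_zero, zero_add, e, map_pow]
    split_ifs with hij
    · exact iff_of_true (mul_ne_zero h (mul_ne_zero h (mul_ne_zero (pow_ne_zero _ h0) one_ne_zero))) hij
    · simp [hij]
  · intro c d h o
    have h0 := aeval_nodeForm_eq_zero (s := s) h
    exact jet_mul_eq_zero_of_aeval o h0 (by rw [map_mul, h0, zero_mul])

/-- A form singular at all nodes and vanishing on further lines. -/
theorem exists_form_vanishing {β : Type*} (u : β → K) (T : Finset β) {δ : ℕ}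
    (hδ : Fintype.card α + T.card ≤ δ) :
    ∃ f : MvPolynomial (Fin 3) K, f.IsHomogeneous δ ∧
      (∀ c d, c ≠ d → ∀ o, jet K (conicPoint (s c) (s d)) o f = 0) ∧
      (∀ P : Fin 3 → K, ∀ l ∈ T, aeval P (lineForm (conicLine (u l))) = 0 → aeval P f = 0) ∧
      ∀ P : Fin 3 → K, P 0 ≠ 0 → (∀ l, aeval P (lineForm (conicLine (s l))) ≠ 0) →
        (∀ l ∈ T, aeval P (lineForm (conicLine (u l))) ≠ 0) → aeval P f ≠ 0 := by
  refine ⟨(∏ l, lineForm (conicLine (s l))) * ((∏ l ∈ T, lineForm (conicLine (u l))) *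
    X 0 ^ (δ - (Fintype.card α + T.card))), ?_, ?_, ?_, ?_⟩
  · have h := IsHomogeneous.prod T
      (fun l => lineForm (conicLine (u l))) (fun _ => 1) fun i _ => isHomogeneous_lineForm _
    rw [Finset.sum_const, smul_eq_mul, mul_one] at h
    convert (isHomogeneous_prod_lineForm fun l => conicLine (s l)).mul
      (h.mul (isHomogeneous_X_pow (0 : Fin 3) (δ - (Fintype.card α + T.card)))) using 1
    omega
  · intro c d hcd o
    -- Two distinct factors pass through the node, so both parts of the product vanish there.
    rw [← Finset.mul_prod_erase _ _ (Finset.mem_univ c), mul_assoc]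
    refine jet_mul_eq_zero_of_aeval o (by rw [aeval_conicPoint]; ring) ?_
    rw [map_mul, map_prod, Finset.prod_eq_zero (i := d) (by simp [hcd.symm])
      (by rw [aeval_conicPoint]; ring), zero_mul]
  · intro P l hl h
    simp only [map_mul, map_prod]
    rw [Finset.prod_eq_zero hl h]
    ring
  · intro P h0 h1 h2
    simp only [map_mul, map_prod, map_pow, aeval_X]
    exact mul_ne_zero (Finset.prod_ne_zero_iff.2 fun l _ => h1 l)
      (mul_ne_zero (Finset.prod_ne_zero_iff.2 h2) (pow_ne_zero _ h0))

end Conic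

/-! ### Independence in the special position on the conic. -/

namespace TraceType

variable {t : TraceType} {M : Finset (Fin t.starLines × Fin t.starLines)} {K : Type*} [Field K]

/-- A special position: the nonreduced components are supported at nodes of the dual lines of a
conic with parameters `s`, the star consists of the dual lines with parameters `u`, and the
collinear points are the intersections of these with the dual line with parameter `w`. -/
def conicConfiguration {k : ℕ} (s : Fin k → K) (u : ℕ → K) (w : K)
    (ν : Fin t.doubles ⊕ Fin t.lengthTwos → Fin k × Fin k) (P : Fin t.points → Fin 3 → K) :
    t.Coord → K
  | .line _ _ => 0
  | .double i c => conicPoint (s (ν (.inl i)).1) (s (ν (.inl i)).2) c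
  | .support i c => conicPoint (s (ν (.inr i)).1) (s (ν (.inr i)).2) c
  | .direction _ c => (Pi.single (Fin.succ (0 : Fin 2)) 1 : Fin 3 → K) c
  | .star i c => conicLine (u i) c
  | .point i c => P i c
  | .base e c => ![![1, -w, 0], ![0, -1, w]] e c
  | .collinear i e => ![1, u i] e

section

variable {k : ℕ} {s : Fin k → K} {u : ℕ → K} {w : K}
  {ν : Fin t.doubles ⊕ Fin t.lengthTwos → Fin k × Fin k} {P : Fin t.points → Fin 3 → K}

theorem center_collinear_conicConfiguration (i : Fin t.collinear) :
    center (M := M) (conicConfiguration s u w ν P) (.inl (.inr (.inr (.inr i)))) =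
      conicPoint w (u i) := by
  ext c
  fin_cases c <;> simp [center, conicConfiguration, conicPoint] <;> ring

/-- Indices of the conditions imposed by the components other than general points. -/
abbrev CoreCondition (t : TraceType) (M : Finset (Fin t.starLines × Fin t.starLines)) : Type :=
  Σ x : t.Core M, Option (Fin (tangentDim (.inl x : t.Component M)))

theorem condition_conicConfiguration_inl (P' : Fin t.points → Fin 3 → K) (i : t.CoreCondition M) :
    condition K (conicConfiguration s u w ν P) (⟨.inl i.1, i.2⟩ : t.Condition M) =
      condition K (conicConfiguration s u w ν P') ⟨.inl i.1, i.2⟩ := by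
  obtain ⟨x | x | x | x, o⟩ := i <;> rfl

/-- An order of the conditions for which they form a triangular system. -/
def conditionRank : t.CoreCondition M → ℕ
  | ⟨.inl _, none⟩ => 2
  | ⟨.inl _, some _⟩ => 1
  | ⟨.inr (.inl _), none⟩ => 2
  | ⟨.inr (.inl _), some _⟩ => 1
  | ⟨.inr (.inr _), _⟩ => 0

/-- A dual form for a value at a node may have uncontrolled derivatives there and uncontrolled
values at star or collinear points; a dual form for a derivative may be uncontrolled only at the
latter. The ranks allow exactly this. Star and collinear points come last, with forms singular at
all nodes; the degree bounds in `h` account for `k` lines plus `t.starLines - 2` or `t.collinear -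
1` further ones. -/
theorem exists_form_dual_condition (hs : Function.Injective s) (hu : Function.Injective u)
    (hsu : ∀ c l, u l ≠ s c) (hsw : ∀ c, w ≠ s c) (huw : ∀ l, u l ≠ w)
    (hν : Function.Injective ν) (hlt : ∀ n, (ν n).1 < (ν n).2) {δ : ℕ}
    (hδ : 2 * (k - 2) + 1 ≤ δ)
    (h : (t.collinear = 0 ∧ k + t.starLines ≤ δ + 2) ∨
      (t.starLines = 0 ∧ k + t.collinear ≤ δ + 1)) (i : t.CoreCondition M) :
    ∃ f ∈ homogeneousSubmodule (Fin 3) K δ,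
      condition K (conicConfiguration s u w ν P) (⟨.inl i.1, i.2⟩ : t.Condition M) f ≠ 0 ∧
        ∀ j : t.CoreCondition M, j ≠ i → conditionRank i ≤ conditionRank j →
          condition K (conicConfiguration s u w ν P) (⟨.inl j.1, j.2⟩ : t.Condition M) f = 0 := by
  classical
  -- Distinct pairs of lines: one line through the second node misses the first. Ordering the pairs
  -- rules out a swap.
  have hnode (n n') (hn : n' ≠ n) : ((ν n').1 ≠ (ν n).1 ∧ (ν n').1 ≠ (ν n).2) ∨
      ((ν n').2 ≠ (ν n).1 ∧ (ν n').2 ≠ (ν n).2) := by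
    have h1 := hlt n
    have h2 := hlt n'
    by_contra! hc
    refine hn (hν (Prod.ext ?_ ?_)) <;> grind
  have hδ' : 2 * (Fintype.card (Fin k) - 2) + 1 ≤ δ := by simpa using hδ
  rcases i with ⟨n | n | ⟨⟨a, b⟩, hab, hM⟩ | l, _ | d⟩
  · obtain ⟨f, hf, h0, hz⟩ :=
      exists_form_dual_value hs (hlt (.inl n)).ne (Nat.le_of_succ_le hδ')
    refine ⟨f, hf, h0, ?_⟩
    rintro ⟨n' | n' | x, _ | d'⟩ hne hr
    · exact hz _ _ (hnode _ _ fun e => hne (by cases e; rfl)) none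
    · simp [conditionRank] at hr
    · exact hz _ _ (hnode _ (.inr n') (by simp)) none
    · simp [conditionRank] at hr
    · simp [conditionRank] at hr
    · simp [conditionRank] at hr
  · obtain ⟨f, hf, h0, h1, hz⟩ := exists_form_dual_derivative hs (hlt (.inl n)).ne hδ' d
    refine ⟨f, hf, (h1 d).2 rfl, ?_⟩
    rintro ⟨n' | n' | x, o⟩ hne hr
    · by_cases hn : n' = n
      · subst hn
        cases o with
        | none => exact h0
        | some d' =>
          have hd : d' ≠ d := fun e => hne (by rw [e])
          exact not_not.1 (mt (h1 d').1 hd)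
      · exact hz _ _ (hnode _ (.inl n') (by simpa using hn)) _
    · exact hz _ _ (hnode _ (.inr n') (by simp)) _
    · simp [conditionRank] at hr
  · obtain ⟨f, hf, h0, hz⟩ :=
      exists_form_dual_value hs (hlt (.inr n)).ne (Nat.le_of_succ_le hδ')
    refine ⟨f, hf, h0, ?_⟩
    rintro ⟨n' | n' | x, _ | d'⟩ hne hr
    · exact hz _ _ (hnode _ (.inl n') (by simp)) none
    · simp [conditionRank] at hr
    · exact hz _ _ (hnode _ _ fun e => hne (by cases e; rfl)) none
    · simp [conditionRank] at hr
    · simp [conditionRank] at hr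
    · simp [conditionRank] at hr
  · obtain ⟨f, hf, h0, h1, hz⟩ := exists_form_dual_derivative hs (hlt (.inr n)).ne hδ' 0
    refine ⟨f, hf, (h1 0).2 rfl, ?_⟩
    rintro ⟨n' | n' | x, o⟩ hne hr
    · exact hz _ _ (hnode _ (.inl n') (by simp)) _
    · by_cases hn : n' = n
      · subst hn
        cases o with
        | none => exact h0
        | some d' =>
          exact absurd (by rw [@Subsingleton.elim (Fin 1) _ d' d]) hne
      · exact hz _ _ (hnode _ (.inr n') (by simpa using hn)) _
    · simp [conditionRank] at hr
  · have hcard : ((Finset.univ.erase a).erase b).card = t.starLines - 2 := by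
      rw [Finset.card_erase_of_mem (by simp [hab.ne']), Finset.card_erase_of_mem (by simp),
        Finset.card_univ, Fintype.card_fin, Nat.sub_sub]
    have ha := a.2
    have hb := b.2
    have hab' : (a : ℕ) < b := hab
    obtain ⟨f, hf, hz, h0, h1⟩ := exists_form_vanishing (s := s) (fun l : Fin t.starLines => u l)
      ((Finset.univ.erase a).erase b) (δ := δ) (by rw [hcard, Fintype.card_fin]; omega)
    have huab : u a - u b ≠ 0 := sub_ne_zero.2 (hu.ne hab'.ne)
    refine ⟨f, hf, h1 (crossProduct (conicLine (u a)) (conicLine (u b))) ?_ (fun l => ?_)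
      (fun l hl => ?_), ?_⟩
    · rw [crossProduct_conicLine]
      simpa [conicPoint] using huab
    · rw [aeval_crossProduct_conicLine]
      exact mul_ne_zero huab (mul_ne_zero (sub_ne_zero.2 (hsu _ _).symm)
        (sub_ne_zero.2 (hsu _ _).symm))
    · rw [aeval_crossProduct_conicLine]
      simp only [Finset.mem_erase] at hl
      exact mul_ne_zero huab (mul_ne_zero
        (sub_ne_zero.2 (hu.ne (Fin.val_ne_of_ne hl.2.1)))
        (sub_ne_zero.2 (hu.ne (Fin.val_ne_of_ne hl.1))))
    · rintro ⟨n' | n' | ⟨⟨c, d⟩, hcd, hM'⟩ | l', o⟩ hne hr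
      · exact hz _ _ (hlt (.inl n')).ne _
      · exact hz _ _ (hlt (.inr n')).ne _
      · cases o with
        | some e => exact e.elim0
        | none =>
          have hne' : (c, d) ≠ (a, b) := fun e => hne (by cases e; rfl)
          have hex : (c ≠ a ∧ c ≠ b) ∨ (d ≠ a ∧ d ≠ b) := by
            have h1 : a < b := hab
            have h2 : c < d := hcd
            by_contra! hc
            refine hne' (Prod.ext ?_ ?_) <;> grind
          rcases hex with hex | hex
          · refine h0 (crossProduct (conicLine (u c)) (conicLine (u d))) c (by simp [hex]) ?_
            rw [aeval_crossProduct_conicLine]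
            ring
          · refine h0 (crossProduct (conicLine (u c)) (conicLine (u d))) d (by simp [hex]) ?_
            rw [aeval_crossProduct_conicLine]
            ring
      · have := l'.2
        omega
  · exact d.elim0
  · have hl := l.2
    obtain ⟨f, hf, hz, h0, h1⟩ := exists_form_vanishing (s := s) (fun l : Fin t.collinear => u l)
      (Finset.univ.erase l) (δ := δ) (by
        rw [Finset.card_erase_of_mem (by simp), Finset.card_univ, Fintype.card_fin,
          Fintype.card_fin]
        omega)
    have hcond (l' : Fin t.collinear) :
        condition K (conicConfiguration s u w ν P)
          (⟨.inl (.inr (.inr (.inr l'))), none⟩ : t.Condition M) f =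
            aeval (conicPoint w (u l')) f := by
      rw [← center_collinear_conicConfiguration (M := M) (s := s) (ν := ν) (P := P)]
      rfl
    refine ⟨f, hf, ?_, ?_⟩
    · rw [hcond]
      refine h1 _ (by simp [conicPoint]) (fun c => ?_) fun l' hl' => ?_
      · rw [aeval_conicPoint]
        exact mul_ne_zero (sub_ne_zero.2 (hsw _).symm) (sub_ne_zero.2 (hsu _ _).symm)
      · rw [aeval_conicPoint]
        exact mul_ne_zero (sub_ne_zero.2 (huw _))
          (sub_ne_zero.2 (hu.ne (Fin.val_ne_of_ne (Finset.ne_of_mem_erase hl'))))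
    · rintro ⟨n' | n' | ⟨⟨c, d⟩, hcd, hM'⟩ | l', o⟩ hne hr
      · exact hz _ _ (hlt (.inl n')).ne _
      · exact hz _ _ (hlt (.inr n')).ne _
      · have := c.2
        omega
      · cases o with
        | some e => exact e.elim0
        | none =>
          rw [hcond]
          have hne' : l' ≠ l := fun e => hne (by rw [e])
          refine h0 _ l' (by simpa using hne') ?_
          rw [aeval_conicPoint]
          ring
  · exact d.elim0

end

/-! ### Counting conditions and the numerical criterion. -/

theorem card_lt_pairs (n : ℕ) : Fintype.card {x : Fin n × Fin n // x.1 < x.2} = n.choose 2 := by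
  rw [Fintype.card_congr (Equiv.subtypeProdEquivSigmaSubtype fun a b : Fin n => a < b),
    Fintype.card_sigma, Nat.choose_two_right, ← Finset.sum_range_id,
    ← Finset.sum_range_reflect, ← Fin.sum_univ_eq_sum_range fun i => n - 1 - i]
  refine Finset.sum_congr rfl fun i _ => ?_
  rw [Fintype.card_subtype, ← Fin.card_Ioi]
  congr 1
  ext j
  simp

theorem card_core_star {b : ℕ} (hM : M.card = b) (hlt : ∀ x ∈ M, x.1 < x.2) :
    Fintype.card {x : Fin t.starLines × Fin t.starLines // x.1 < x.2 ∧ x ∉ M} + b =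
      t.starLines.choose 2 := by
  classical
  rw [← card_lt_pairs, Fintype.card_subtype, Fintype.card_subtype, ← hM,
    ← Finset.card_union_of_disjoint]
  · congr 1
    ext x
    by_cases hx : x ∈ M <;> simp [hx]
    exact hlt x hx
  · rw [Finset.disjoint_left]
    intro x hx
    exact (Finset.mem_filter.1 hx).2.2

/-- A numerical criterion for the good postulation of general trace schemes. -/
theorem holdsGenerically_goodPostulation_of_numerics [Infinite K] (hM : t.IsOmittedSet M)
    {k δ : ℕ} (hnodes : t.doubles + t.lengthTwos ≤ k.choose 2) (hδ : 2 * (k - 2) + 1 ≤ δ)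
    (h : (t.collinear = 0 ∧ k + t.starLines ≤ δ + 2) ∨
      (t.starLines = 0 ∧ k + t.collinear ≤ δ + 1))
    (hcount : 3 * t.doubles + 2 * t.lengthTwos + t.starLines.choose 2 + t.points + t.collinear =
      (δ + 2).choose 2 + t.omitted) :
    HoldsGenerically fun v : t.Coord → K => GoodPostulation (t.ideal M v) := by
  classical
  have hstar := card_core_star hM.1 hM.2.1
  have hcore : Fintype.card (t.CoreCondition M) + t.points =
      Module.finrank K (homogeneousSubmodule (Fin 3) K δ) := by
    rw [finrank_homogeneousSubmodule, Fintype.card_fin, show 3 + δ - 1 = δ + 2 by omega,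
      Nat.choose_symm_add, Fintype.card_sigma]
    simp only [Fintype.card_option, Fintype.card_fin, Fintype.sum_sum_type]
    simp only [tangentDim, Finset.sum_const, Finset.card_univ, smul_eq_mul, Fintype.card_fin]
    omega
  have hcard : Fintype.card (t.Condition M) =
      Module.finrank K (homogeneousSubmodule (Fin 3) K δ) := by
    rw [← hcore, Fintype.card_sigma, Fintype.card_sigma, Fintype.sum_sum_type]
    congr 1
    simp only [Fintype.card_option, Fintype.card_fin]
    simp only [tangentDim, Finset.sum_const, Finset.card_univ, smul_eq_mul, Fintype.card_fin,
      zero_add, mul_one]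
  obtain ⟨ν⟩ : Nonempty (Fin t.doubles ⊕ Fin t.lengthTwos ↪ {x : Fin k × Fin k // x.1 < x.2}) :=
    Function.Embedding.nonempty_of_card_le (by simpa [card_lt_pairs] using hnodes)
  let σ : ℕ ↪ K := Infinite.natEmbedding K
  -- Disjoint blocks of parameters: `k` lines carrying the nodes, then `w`, then the star or
  -- collinear parameters, so all separation hypotheses hold.
  let v (P : Fin t.points → Fin 3 → K) : t.Coord → K := conicConfiguration
    (fun c : Fin k => σ c) (fun l => σ (k + 1 + l)) (σ k) (fun n => (ν n).1) P
  let Φ : MvPolynomial (Fin 3) K →ₗ[K] (t.CoreCondition M → K) :=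
    LinearMap.pi fun i => condition K (v 0) ⟨.inl i.1, i.2⟩
  have hΦ := exists_eq_of_triangular (homogeneousSubmodule (Fin 3) K δ) Φ conditionRank
    (exists_form_dual_condition (σ.injective.comp Fin.val_injective)
      (fun i j hij => by simpa using hij) (fun c l => σ.injective.ne (by omega))
      (fun c => σ.injective.ne (by omega)) (fun l => σ.injective.ne (by omega))
      (Subtype.val_injective.comp ν.injective) (fun n => (ν n).2) hδ h)
  obtain ⟨P, hP⟩ := exists_points _ Φ hΦ t.points hcore.le
  refine holdsGenerically_goodPostulation hcard (v P) fun y => ?_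
  obtain ⟨f, hf, hy, hz⟩ := hP (fun i => y ⟨.inl i.1, i.2⟩) fun i => y ⟨.inr i, none⟩
  refine ⟨f, hf, funext ?_⟩
  rintro ⟨x | x, o⟩
  · rw [← congrFun hy ⟨x, o⟩]
    exact LinearMap.congr_fun (condition_conicConfiguration_inl 0 ⟨x, o⟩) f
  · cases o with
    | none => exact hz x
    | some d => exact d.elim0

theorem Is.holdsGenerically_goodPostulation [Infinite K] (hM : t.IsOmittedSet M)
    {e s m a b p q : ℚ} (ht : t.Is e s m a b p q) {k : ℕ} (δ : ℕ) (hδ : 2 * (k - 2) + 1 ≤ δ)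
    (hnodes : s + m ≤ k * (k - 1) / 2)
    (h : (q = 0 ∧ k + a ≤ δ + 2) ∨ (a = 0 ∧ k + q ≤ δ + 1))
    (hcount : 3 * s + 2 * m + a * (a - 1) / 2 + p + q = (δ + 2) * (δ + 1) / 2 + b) :
    HoldsGenerically fun v : t.Coord → K => GoodPostulation (t.ideal M v) := by
  obtain ⟨-, rfl, rfl, rfl, rfl, rfl, rfl⟩ := ht
  refine holdsGenerically_goodPostulation_of_numerics hM (k := k) (δ := δ) ?_ hδ
    (by exact_mod_cast h) ?_
  · rw [← Nat.cast_choose_two] at hnodes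
    exact_mod_cast hnodes
  · rw [← Nat.cast_choose_two, show (δ + 2 : ℚ) * (δ + 1) / 2 = ((δ + 2).choose 2 : ℕ) by
      rw [Nat.cast_choose_two]
      push_cast
      ring] at hcount
    exact_mod_cast hcount

end TraceType

/-! ### Numerical verification for the individual types. -/

theorem theorem6p2 {K : Type*} [Field K] [IsAlgClosed K] (k : ℕ) (hk : 1 ≤ k)
    (t : TraceType) (ht : IsReductionTrace k t)
    (M : Finset (Fin t.starLines × Fin t.starLines)) (hM : t.IsOmittedSet M) :
    HoldsGenerically (fun v : t.Coord → K => GoodPostulation (t.ideal M v)) := by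
  have : Infinite K := IsAlgClosed.instInfinite
  obtain ⟨j, rfl⟩ := Nat.exists_eq_add_of_le' hk
  have hj : (0 : ℚ) ≤ j := j.cast_nonneg
  -- In each case the degree supplied is the one whose space of forms has dimension equal to the
  -- length of the zero-dimensional part: `2k - 2`, `2k - 1`, `2k` or `2k + 1`, where `k = j + 1` is
  -- also the number of lines carrying the nodes.
  cases ht with
  | red_odd₀ _ h =>
    refine h.holdsGenerically_goodPostulation hM (2 * j + 1) (k := j + 1) (by omega) ?_ (Or.inl ⟨rfl, ?_⟩) ?_ <;>
      push_cast <;> nlinarith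
  | red_odd₁ _ h =>
    refine h.holdsGenerically_goodPostulation hM (2 * j + 1) (k := j + 1) (by omega) ?_ (Or.inl ⟨rfl, ?_⟩) ?_ <;>
      push_cast <;> nlinarith
  | red_odd₂ _ h =>
    -- With degree `2 * j`, the bound `2 * (k - 2) + 1 ≤ δ` in truncated subtraction fails at `k =
    -- 1`; there the number of length 2 schemes would be -1.
    have hj0 : j ≠ 0 := by
      rintro rfl
      have h0 := h.2.2.1
      have h1 : (0 : ℚ) ≤ t.lengthTwos := Nat.cast_nonneg _
      norm_num at h0
      linarith
    refine h.holdsGenerically_goodPostulation hM (2 * j) (k := j + 1) (by omega) ?_ (Or.inl ⟨rfl, ?_⟩) ?_ <;>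
      push_cast <;> nlinarith
  | red_even₀ _ h =>
    refine h.holdsGenerically_goodPostulation hM (2 * j + 1) (k := j + 1) (by omega) ?_ (Or.inl ⟨rfl, ?_⟩) ?_ <;>
      push_cast <;> nlinarith
  | red_even₁ _ h =>
    refine h.holdsGenerically_goodPostulation hM (2 * j + 1) (k := j + 1) (by omega) ?_ (Or.inl ⟨rfl, ?_⟩) ?_ <;>
      push_cast <;> nlinarith
  | red_even₂ hk h =>
    -- The degree bound again fails at `k = 1`, excluded here by parity.
    have hj0 : j ≠ 0 := by
      rintro rfl
      exact absurd hk (by decide)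
    refine h.holdsGenerically_goodPostulation hM (2 * j) (k := j + 1) (by omega) ?_ (Or.inl ⟨rfl, ?_⟩) ?_ <;>
      push_cast <;> nlinarith
  | init₀ h =>
    refine h.holdsGenerically_goodPostulation hM (2 * j + 1) (k := j + 1) (by omega) ?_ (Or.inl ⟨rfl, ?_⟩) ?_ <;>
      push_cast <;> nlinarith
  | init₀_odd _ h =>
    refine h.holdsGenerically_goodPostulation hM (2 * j + 1) (k := j + 1) (by omega) ?_ (Or.inl ⟨rfl, ?_⟩) ?_ <;>
      push_cast <;> nlinarith
  | init₀_even _ h =>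
    refine h.holdsGenerically_goodPostulation hM (2 * j + 1) (k := j + 1) (by omega) ?_ (Or.inl ⟨rfl, ?_⟩) ?_ <;>
      push_cast <;> nlinarith
  | init₁ h =>
    refine h.holdsGenerically_goodPostulation hM (2 * j + 1) (k := j + 1) (by omega) ?_ (Or.inl ⟨rfl, ?_⟩) ?_ <;>
      push_cast <;> nlinarith
  | init₁_odd _ h =>
    refine h.holdsGenerically_goodPostulation hM (2 * j + 2) (k := j + 1) (by omega) ?_ (Or.inl ⟨rfl, ?_⟩) ?_ <;>
      push_cast <;> nlinarith
  | init₁_odd' _ h =>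
    refine h.holdsGenerically_goodPostulation hM (2 * j + 1) (k := j + 1) (by omega) ?_ (Or.inl ⟨rfl, ?_⟩) ?_ <;>
      push_cast <;> nlinarith
  | init₁_even _ h =>
    refine h.holdsGenerically_goodPostulation hM (2 * j + 2) (k := j + 1) (by omega) ?_ (Or.inl ⟨rfl, ?_⟩) ?_ <;>
      push_cast <;> nlinarith
  | init₁_even' _ h =>
    refine h.holdsGenerically_goodPostulation hM (2 * j + 1) (k := j + 1) (by omega) ?_ (Or.inl ⟨rfl, ?_⟩) ?_ <;>
      push_cast <;> nlinarith
  | init₂ h =>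
    refine h.holdsGenerically_goodPostulation hM (2 * j + 2) (k := j + 1) (by omega) ?_ (Or.inr ⟨rfl, ?_⟩) ?_ <;>
      push_cast <;> nlinarith
  | init₂_odd _ h =>
    refine h.holdsGenerically_goodPostulation hM (2 * j + 3) (k := j + 1) (by omega) ?_ (Or.inl ⟨rfl, ?_⟩) ?_ <;>
      push_cast <;> nlinarith
  | init₂_odd' _ h =>
    refine h.holdsGenerically_goodPostulation hM (2 * j + 1) (k := j + 1) (by omega) ?_ (Or.inl ⟨rfl, ?_⟩) ?_ <;>
      push_cast <;> nlinarith
  | init₂_even _ h =>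
    refine h.holdsGenerically_goodPostulation hM (2 * j + 3) (k := j + 1) (by omega) ?_ (Or.inl ⟨rfl, ?_⟩) ?_ <;>
      push_cast <;> nlinarith
  | init₂_even' _ h =>
    refine h.holdsGenerically_goodPostulation hM (2 * j + 1) (k := j + 1) (by omega) ?_ (Or.inl ⟨rfl, ?_⟩) ?_ <;>
      push_cast <;> nlinarith
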